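/- Let $d\ge 1$ and let $G=\mathrm{SO}^\circ(d+1,1)$ be the group of orientation-preserving isometries of $\mathbb H^{d+1}$. Let $K\cong\mathrm{SO}(d+1)$ be the stabilizer of a base point, $A=\{a_t:t\in\mathbb R\}$ a one-parameter group of hyperbolic translations along a geodesic through this point, parametrized by arc length (so $\mathrm{Ad}(a_t)=e^{t}$ on the Lie algebra of the group $N$ below), $M\cong\mathrm{SO}(d)$ the centralizer of $A$ in $K$, and $N=\{g\in G: a_{-t}ga_t\to e \text{ as } t\to+\infty\}$. For $g\in G$ write the Iwasawa decomposition $g=\kappa(g)\,a_{H(g)}\,n_g$ with $\kappa(g)\in K$, $H(g)\in\mathbb R$, $n_g\in N$. Let $dk$, $dm$ be the Haar probability measures of $K$, $M$. For an irreducible unitary representation $\tau$ of $K$ or $M$ put $\chi_\tau=\dim(\tau)\,\mathrm{tr}\,\tau$. For $s\in\mathbb C$ let $G$ act on $L^2(K)$ by $[U^s(g)v](k)=e^{-sH(g^{-1}k)}v(\kappa(g^{-1}k))$; the restriction of $U^s$ to $K$ is the left regular representation. For $\upsilon\in\hat M$ let $L^2(K:\upsilon)$ be the space of $v\in L^2(K)$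 with $\int_M\overline{\chi_\upsilon(m)}\,v(\cdot\, m)\,dm=v$. Let $\upsilon\in\hat M$, $s\in(\tfrac d2,d)$, and let $\mathcal U(\upsilon,s)$ be a complementary series representation, that is, a closed, irreducible $U^s(G)$-invariant subspace of $L^2(K:\upsilon)$ which carries a (continuous) $U^s(G)$-invariant inner product. For $\tau\in\hat K$ let $\mathsf P_\tau=\int_K\overline{\chi_\tau(k)}\,U^s(k)\,dk$ and $\mathcal U(\upsilon,s)_\tau=\{v\in\mathcal U(\upsilon,s):\mathsf P_\tau v=v\}$, a finite-dimensional space of continuous functions on $K$; $\tau$ is called a $K$-type of $\mathcal U(\upsilon,s)$ if this space is non-zero. For a $K$-type $\tau$ let $\boldsymbol\chi_\tau=\sum_i\overline{v_i(e)}\,v_i$, where $(v_i)$ is an orthonormal basis of $\mathcal U(\upsilon,s)_\tau$ in $L^2(K)$ (the vector does not depend on the basis). For $K$-types $\tau_1,\tau_2$ define $T_{\tau_1}^{\tau_2}:\mathcal U(\upsilon,s)_{\tau_1}\to\mathcal U(\upsilon,s)_{\tau_2}$ by $T_{\tau_1}^{\tau_2}v=\int_M v(m)\,U^s(m)\boldsymbol\chi_{\tau_2}\,dm$.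 Then for all $K$-types $\tau_1,\tau_2$ of $\mathcal U(\upsilon,s)$ and all $g\in G$, as operators from $\mathcal U(\upsilon,s)_{\tau_1}$ to $\mathcal U(\upsilon,s)_{\tau_2}$, $$\mathsf P_{\tau_2}U^s(g)\mathsf P_{\tau_1}=\int_K e^{(s-d)H(gk)}\,U^s(\kappa(gk))\,T_{\tau_1}^{\tau_2}\,U^s(k^{-1})\,dk,$$ that is, for every $v\in\mathcal U(\upsilon,s)_{\tau_1}$ the integral of the right-hand side applied to $v$ converges absolutely in $L^2(K)$ and equals $\mathsf P_{\tau_2}U^s(g)\mathsf P_{\tau_1}v$. -/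

import Mathlib

set_option linter.unusedSectionVars false
set_option linter.unusedSimpArgs false

namespace Eisenstein

open MeasureTheory Matrix Filter Topology
open scoped ENNReal ComplexConjugate

/-! ### Harmonic analysis on a compact group -/

section CompactGroup

variable (Γ : Type) [Group Γ] [TopologicalSpace Γ] [IsTopologicalGroup Γ] [CompactSpace Γ]
  [MeasurableSpace Γ] [BorelSpace Γ]

/-- The Haar probability measure of a compact group. -/
noncomputable def haarProb : Measure Γ := Measure.haarMeasure ⊤

instance : (haarProb Γ).IsHaarMeasure := by unfold haarProb; infer_instance

instance : IsProbabilityMeasure (haarProb Γ) :=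
  ⟨by simpa [haarProb] using Measure.haarMeasure_self (K₀ := (⊤ : TopologicalSpace.PositiveCompacts Γ))⟩

instance : (haarProb Γ).Regular := by unfold haarProb; infer_instance

instance : (haarProb Γ).IsMulRightInvariant where
  map_mul_right_eq_self g := by
    have : IsProbabilityMeasure (Measure.map (· * g) (haarProb Γ)) :=
      Measure.isProbabilityMeasure_map (measurable_mul_const g).aemeasurable
    exact Measure.isHaarMeasure_eq_of_isProbabilityMeasure _ _

/-- The Hilbert space `L²(Γ)`. Its `inner` is linear in the second variable. -/
abbrev L2 : Type := Lp ℂ 2 (haarProb Γ)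

/-- A (continuous, finite dimensional) irreducible unitary representation of `Γ`, in matrix form.
Equivalence classes of these are the elements of the unitary dual of the compact group `Γ`. -/
structure UnitaryIrrep where
  dim : ℕ
  hom : Γ →* Matrix.unitaryGroup (Fin dim) ℂ
  continuous_hom : Continuous fun k => (hom k : Matrix (Fin dim) (Fin dim) ℂ)
  dim_pos : 0 < dim
  irreducible : ∀ W : Submodule ℂ (Fin dim → ℂ),
    (∀ k, ∀ w ∈ W, (hom k : Matrix (Fin dim) (Fin dim) ℂ) *ᵥ w ∈ W) → W = ⊥ ∨ W = ⊤

variable {Γ}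

/-- `χ_τ(k) = dim(τ) · tr τ(k)`. -/
noncomputable def UnitaryIrrep.char (τ : UnitaryIrrep Γ) (k : Γ) : ℂ :=
  τ.dim * Matrix.trace (τ.hom k : Matrix (Fin τ.dim) (Fin τ.dim) ℂ)

/-- The left regular representation, `(λ(k) v)(x) = v(k⁻¹ x)`. -/
noncomputable def leftReg (k : Γ) (v : L2 Γ) : L2 Γ :=
  Lp.compMeasurePreserving (fun x => k⁻¹ * x) (measurePreserving_mul_left (haarProb Γ) k⁻¹) v

/-- The right regular representation, `(ρ(k) v)(x) = v(x k)`. -/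
noncomputable def rightReg (k : Γ) (v : L2 Γ) : L2 Γ :=
  Lp.compMeasurePreserving (fun x => x * k) (measurePreserving_mul_right (haarProb Γ) k) v

/-- The operator `P_τ = ∫_Γ conj(χ_τ(k)) λ(k) dk` on `L²(Γ)`. -/
noncomputable def isoProj (τ : UnitaryIrrep Γ) (v : L2 Γ) : L2 Γ :=
  ∫ k, conj (τ.char k) • leftReg k v ∂(haarProb Γ)

/-- For a compact subgroup `H` of `Γ` and an irreducible representation `υ` of `H`, the space
`L²(Γ : υ)` of all `v` such that `∫_H conj(χ_υ(m)) ρ(m) v dm = v`. -/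
def rightIsotypic {H : Subgroup Γ} [CompactSpace H] (υ : UnitaryIrrep H) : Set (L2 Γ) :=
  {v | ∫ m : H, conj (υ.char m) • rightReg (m : Γ) v ∂(haarProb H) = v}

open Classical in
/-- The continuous function on `Γ` that represents `v ∈ L²(Γ)`; it is unique, since Haar measure
charges non-empty open sets. It exists for every `v` in an isotypic subspace, see
`exists_continuous_of_mem_isotypic`; where there is none, the value is `0`. -/
noncomputable def contRep (v : L2 Γ) : Γ → ℂ :=
  if h : ∃ f : C(Γ, ℂ), ContinuousMap.toLp 2 (haarProb Γ) ℂ f = v then h.choose else 0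

/-! #### Isotypic subspaces are well defined and finite dimensional -/

lemma UnitaryIrrep.continuous_entry (τ : UnitaryIrrep Γ) (i j : Fin τ.dim) :
    Continuous fun k => (τ.hom k : Matrix (Fin τ.dim) (Fin τ.dim) ℂ) i j :=
  τ.continuous_hom.matrix_elem i j

lemma UnitaryIrrep.continuous_char (τ : UnitaryIrrep Γ) : Continuous τ.char :=
  continuous_const.mul τ.continuous_hom.matrix_trace

lemma leftReg_add (k : Γ) (v w : L2 Γ) : leftReg k (v + w) = leftReg k v + leftReg k w :=
  map_add _ v w

lemma leftReg_smul (k : Γ) (c : ℂ) (v : L2 Γ) : leftReg k (c • v) = c • leftReg k v :=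
  (Lp.compMeasurePreservingₗ ℂ (fun x => k⁻¹ * x)
    (measurePreserving_mul_left (haarProb Γ) k⁻¹)).map_smul c v

lemma norm_leftReg (k : Γ) (v : L2 Γ) : ‖leftReg k v‖ = ‖v‖ :=
  Lp.norm_compMeasurePreserving v (measurePreserving_mul_left (haarProb Γ) k⁻¹)

lemma leftReg_toLp (k : Γ) (f : C(Γ, ℂ)) :
    leftReg k (ContinuousMap.toLp 2 (haarProb Γ) ℂ f) =
      ContinuousMap.toLp 2 (haarProb Γ) ℂ (f.comp ⟨fun x => k⁻¹ * x, by fun_prop⟩) := by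
  rfl

lemma continuous_translate (f : C(Γ, ℂ)) :
    Continuous fun k : Γ => f.comp ⟨fun x => k⁻¹ * x, by fun_prop⟩ :=
  (ContinuousMap.curry (⟨fun p : Γ × Γ => f (p.1⁻¹ * p.2), by fun_prop⟩ : C(Γ × Γ, ℂ))).continuous

lemma continuous_leftReg (v : L2 Γ) : Continuous fun k : Γ => leftReg k v :=
  Continuous.compMeasurePreservingLp (p := 2) (μ := haarProb Γ) (ν := haarProb Γ)
    (g := fun k : Γ => (⟨fun x => k⁻¹ * x, by fun_prop⟩ : C(Γ, Γ))) (f := fun _ => v) continuous_const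
    (ContinuousMap.curry (⟨fun p : Γ × Γ => p.1⁻¹ * p.2, by fun_prop⟩ : C(Γ × Γ, Γ))).continuous
    (fun k => measurePreserving_mul_left (haarProb Γ) k⁻¹) (by simp)

lemma integrable_of_continuous {E : Type*} [NormedAddCommGroup E] {f : Γ → E}
    (hf : Continuous f) : Integrable f (haarProb Γ) :=
  hf.integrable_of_hasCompactSupport (HasCompactSupport.of_compactSpace f)

lemma integrable_isoProj (τ : UnitaryIrrep Γ) (v : L2 Γ) :
    Integrable (fun k => conj (τ.char k) • leftReg k v) (haarProb Γ) :=
  integrable_of_continuous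
    ((Complex.continuous_conj.comp τ.continuous_char).smul (continuous_leftReg v))

lemma isoProj_add (τ : UnitaryIrrep Γ) (v w : L2 Γ) :
    isoProj τ (v + w) = isoProj τ v + isoProj τ w := by
  simp only [isoProj, leftReg_add, smul_add]
  exact integral_add (integrable_isoProj τ v) (integrable_isoProj τ w)

lemma isoProj_smul (τ : UnitaryIrrep Γ) (c : ℂ) (v : L2 Γ) :
    isoProj τ (c • v) = c • isoProj τ v := by
  simp only [isoProj, leftReg_smul, ← integral_smul]
  congr 1 with k
  rw [smul_comm]

/-- For a subspace `U` of `L²(Γ)`, the subspace `U_τ = {v ∈ U | P_τ v = v}`. -/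
noncomputable def isotypic (τ : UnitaryIrrep Γ) (U : Submodule ℂ (L2 Γ)) :
    Submodule ℂ (L2 Γ) where
  carrier := {v | v ∈ U ∧ isoProj τ v = v}
  zero_mem' := ⟨U.zero_mem, by simpa using isoProj_smul τ 0 0⟩
  add_mem' hv hw := ⟨U.add_mem hv.1 hw.1, by rw [isoProj_add, hv.2, hw.2]⟩
  smul_mem' c v hv := ⟨U.smul_mem c hv.1, by rw [isoProj_smul, hv.2]⟩

/-- The complex conjugates of the matrix coefficients of `τ`. -/
noncomputable def conjEntry (τ : UnitaryIrrep Γ) (p : Fin τ.dim × Fin τ.dim) : C(Γ, ℂ) :=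
  ⟨fun x => conj ((τ.hom x : Matrix (Fin τ.dim) (Fin τ.dim) ℂ) p.1 p.2),
    Complex.continuous_conj.comp (τ.continuous_entry p.1 p.2)⟩

lemma continuous_isoProj (τ : UnitaryIrrep Γ) : Continuous (isoProj τ) := by
  obtain ⟨C, hC⟩ : ∃ C, ∀ k, ‖τ.char k‖ ≤ C := by
    obtain ⟨C, hC⟩ := isCompact_univ.exists_bound_of_continuousOn τ.continuous_char.continuousOn
    exact ⟨C, fun k => hC k trivial⟩
  let L : L2 Γ →ₗ[ℂ] L2 Γ :=
    { toFun := isoProj τ, map_add' := isoProj_add τ, map_smul' := isoProj_smul τ }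
  refine (L.mkContinuous C fun v => ?_).continuous
  have := norm_integral_le_of_norm_le_const (μ := haarProb Γ)
    (f := fun k => conj (τ.char k) • leftReg k v) (C := C * ‖v‖)
    (Eventually.of_forall fun k => by
      rw [norm_smul, norm_leftReg, RCLike.norm_conj]
      exact mul_le_mul_of_nonneg_right (hC k) (norm_nonneg v))
  simpa [L, isoProj] using this

instance : (haarProb Γ).IsInvInvariant where
  inv_eq_self := by
    have : IsProbabilityMeasure (haarProb Γ).inv :=
      Measure.isProbabilityMeasure_map measurable_inv.aemeasurable
    have : (haarProb Γ).inv.IsHaarMeasure :=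
      Measure.isHaarMeasure_of_isCompact_nonempty_interior _ Set.univ isCompact_univ
        (by simp) (by simp) (by simp)
    exact Measure.isHaarMeasure_eq_of_isProbabilityMeasure _ _

lemma isoProj_toLp_mem (τ : UnitaryIrrep Γ) (f : C(Γ, ℂ)) :
    isoProj τ (ContinuousMap.toLp 2 (haarProb Γ) ℂ f) ∈
      (Submodule.span ℂ (Set.range (conjEntry τ))).map
        (ContinuousMap.toLp (E := ℂ) 2 (haarProb Γ) ℂ).toLinearMap := by
  have hint : Integrable (fun k : Γ => conj (τ.char k) •
      f.comp ⟨fun x => k⁻¹ * x, by fun_prop⟩) (haarProb Γ) :=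
    integrable_of_continuous
      ((Complex.continuous_conj.comp τ.continuous_char).smul (continuous_translate f))
  refine ⟨∫ k : Γ, conj (τ.char k) • f.comp ⟨fun x => k⁻¹ * x, by fun_prop⟩ ∂(haarProb Γ),
    ?_, ?_⟩
  · have : (∫ k : Γ, conj (τ.char k) • f.comp ⟨fun x => k⁻¹ * x, by fun_prop⟩ ∂(haarProb Γ)) =
        ∑ i, ∑ j, (τ.dim * ∫ k : Γ, conj ((τ.hom k⁻¹ : Matrix (Fin τ.dim) (Fin τ.dim) ℂ) j i) * f k
          ∂(haarProb Γ)) • conjEntry τ (i, j) := by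
      ext x
      have h1 := (ContinuousMap.evalCLM ℂ x).integral_comp_comm hint
      simp only [ContinuousMap.evalCLM_apply] at h1
      rw [← h1]
      have h2 : ∀ F : Γ → ℂ, ∫ k, F k ∂(haarProb Γ) = ∫ k, F (x * k⁻¹) ∂(haarProb Γ) := by
        intro F
        rw [integral_inv_eq_self (fun k => F (x * k)), integral_mul_left_eq_self]
      rw [h2]
      have h3 : ∀ k : Γ, conj (τ.char (x * k⁻¹)) * f ((x * k⁻¹)⁻¹ * x) = ∑ i, ∑ j, (τ.dim *
          conj ((τ.hom x : Matrix (Fin τ.dim) (Fin τ.dim) ℂ) i j)) *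
          (conj ((τ.hom k⁻¹ : Matrix (Fin τ.dim) (Fin τ.dim) ℂ) j i) * f k) := by
        intro k
        have : (x * k⁻¹)⁻¹ * x = k := by group
        rw [this, UnitaryIrrep.char, map_mul τ.hom, Submonoid.coe_mul, Matrix.trace]
        simp only [Matrix.diag, Matrix.mul_apply, map_mul, map_sum, map_natCast, Finset.mul_sum,
          Finset.sum_mul]
        exact Finset.sum_congr rfl fun i _ => Finset.sum_congr rfl fun j _ => by ring
      have h4 : ∀ i j, Integrable (fun k : Γ => (τ.dim *
          conj ((τ.hom x : Matrix (Fin τ.dim) (Fin τ.dim) ℂ) i j)) *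
          (conj ((τ.hom k⁻¹ : Matrix (Fin τ.dim) (Fin τ.dim) ℂ) j i) * f k)) (haarProb Γ) := by
        intro i j
        refine integrable_of_continuous (continuous_const.mul (Continuous.mul ?_ f.continuous))
        exact Complex.continuous_conj.comp ((τ.continuous_entry j i).comp continuous_inv)
      simp only [ContinuousMap.coe_smul, Pi.smul_apply, ContinuousMap.comp_apply,
        ContinuousMap.coe_mk, smul_eq_mul, ContinuousMap.coe_sum, Finset.sum_apply, h3, conjEntry]
      rw [integral_finsetSum _ fun i _ => integrable_finsetSum _ fun j _ => h4 i j]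
      refine Finset.sum_congr rfl fun i _ => ?_
      rw [integral_finsetSum _ fun j _ => h4 i j]
      refine Finset.sum_congr rfl fun j _ => ?_
      rw [integral_const_mul]
      ring
    rw [this]
    exact Submodule.sum_mem _ fun i _ => Submodule.sum_mem _ fun j _ =>
      Submodule.smul_mem _ _ (Submodule.subset_span ⟨(i, j), rfl⟩)
  · have := (ContinuousMap.toLp (E := ℂ) 2 (haarProb Γ) ℂ).integral_comp_comm hint
    simp only [ContinuousLinearMap.coe_coe]
    rw [← this]
    simp only [isoProj, leftReg_toLp, map_smul]

lemma isoProj_mem (τ : UnitaryIrrep Γ) (v : L2 Γ) :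
    isoProj τ v ∈ (Submodule.span ℂ (Set.range (conjEntry τ))).map
        (ContinuousMap.toLp (E := ℂ) 2 (haarProb Γ) ℂ).toLinearMap := by
  have : FiniteDimensional ℂ (Submodule.span ℂ (Set.range (conjEntry τ))) :=
    FiniteDimensional.span_of_finite ℂ (Set.finite_range _)
  have hcl := Submodule.closed_of_finiteDimensional
    ((Submodule.span ℂ (Set.range (conjEntry τ))).map
        (ContinuousMap.toLp (E := ℂ) 2 (haarProb Γ) ℂ).toLinearMap)
  have := (ContinuousMap.toLp_denseRange (E := ℂ) (μ := haarProb Γ) (𝕜 := ℂ) (p := 2)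
    (by simp)).induction_on (p := fun v => isoProj τ v ∈
      (Submodule.span ℂ (Set.range (conjEntry τ))).map
        (ContinuousMap.toLp (E := ℂ) 2 (haarProb Γ) ℂ).toLinearMap) v
    (hcl.preimage (continuous_isoProj τ)) (isoProj_toLp_mem τ)
  exact this

lemma exists_continuous_of_mem_isotypic {τ : UnitaryIrrep Γ} {U : Submodule ℂ (L2 Γ)} {v : L2 Γ}
    (hv : v ∈ isotypic τ U) : ∃ f : C(Γ, ℂ), ContinuousMap.toLp 2 (haarProb Γ) ℂ f = v := by
  obtain ⟨f, -, hf⟩ := isoProj_mem τ v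
  exact ⟨f, hf.trans hv.2⟩

instance finiteDimensional_isotypic (τ : UnitaryIrrep Γ) (U : Submodule ℂ (L2 Γ)) :
    FiniteDimensional ℂ (isotypic τ U) := by
  have : FiniteDimensional ℂ (Submodule.span ℂ (Set.range (conjEntry τ))) :=
    FiniteDimensional.span_of_finite ℂ (Set.finite_range _)
  exact Submodule.finiteDimensional_of_le
    (S₂ := (Submodule.span ℂ (Set.range (conjEntry τ))).map
        (ContinuousMap.toLp (E := ℂ) 2 (haarProb Γ) ℂ).toLinearMap)
    fun v hv => hv.2 ▸ isoProj_mem τ v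

/-- The vector `χ_τ = ∑ᵢ conj(vᵢ(e)) vᵢ ∈ U_τ`, where `(vᵢ)` is an orthonormal basis of `U_τ`
(it does not depend on the basis). -/
noncomputable def evalVec (τ : UnitaryIrrep Γ) (U : Submodule ℂ (L2 Γ)) : L2 Γ :=
  ∑ i, conj (contRep (stdOrthonormalBasis ℂ (isotypic τ U) i : L2 Γ) 1) •
    (stdOrthonormalBasis ℂ (isotypic τ U) i : L2 Γ)

end CompactGroup
/-! ### The group `SO°(d+1,1)` and its subgroups -/

section Group

/-- Coordinates on `ℝ^{d+2}`: `d + 1` space coordinates `inl i`, `inr 0` and the time coordinate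
`inr 1`. -/
abbrev Idx (d : ℕ) : Type := Fin d ⊕ Fin 2

/-- The matrix of the quadratic form of signature `(d+1, 1)`. -/
def lorentz (d : ℕ) : Matrix (Idx d) (Idx d) ℝ :=
  Matrix.fromBlocks 1 0 0 !![1, 0; 0, -1]

/-- The hyperboloid model of hyperbolic space `ℍ^{d+1}`. -/
def hyperboloid (d : ℕ) : Set (Idx d → ℝ) :=
  {x | x ⬝ᵥ (lorentz d *ᵥ x) = -1 ∧ 0 < x (Sum.inr 1)}

lemma lorentz_quad (d : ℕ) (x y : Idx d → ℝ) : x ⬝ᵥ (lorentz d *ᵥ y) =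
    (∑ i, x (Sum.inl i) * y (Sum.inl i)) + x (Sum.inr 0) * y (Sum.inr 0)
      - x (Sum.inr 1) * y (Sum.inr 1) := by
  simp [lorentz, dotProduct, Matrix.mulVec, Fin.sum_univ_two, Matrix.one_apply]
  ring

lemma lorentz_mulVec {d : ℕ} {g : Matrix (Idx d) (Idx d) ℝ} (hg : gᵀ * lorentz d * g = lorentz d)
    (x y : Idx d → ℝ) :
    (g *ᵥ x) ⬝ᵥ (lorentz d *ᵥ (g *ᵥ y)) = x ⬝ᵥ (lorentz d *ᵥ y) := by
  conv_rhs => rw [← hg]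
  rw [← Matrix.vecMul_transpose, ← Matrix.dotProduct_mulVec, Matrix.mulVec_mulVec,
    Matrix.mulVec_mulVec, Matrix.mul_assoc]

/-- `G = SO°(d+1,1)`, the group of orientation preserving isometries of `ℍ^{d+1}`: the real
matrices of determinant one that preserve the quadratic form and map the hyperboloid sheet
to itself. -/
def G (d : ℕ) : Subgroup (Matrix.SpecialLinearGroup (Idx d) ℝ) where
  carrier := {g | (g : Matrix (Idx d) (Idx d) ℝ)ᵀ * lorentz d * (g : Matrix (Idx d) (Idx d) ℝ)
      = lorentz d ∧ ∀ x ∈ hyperboloid d, (g : Matrix (Idx d) (Idx d) ℝ) *ᵥ x ∈ hyperboloid d}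
  one_mem' := by simp
  mul_mem' := by
    rintro g h ⟨hg, hg'⟩ ⟨hh, hh'⟩
    refine ⟨?_, fun x hx => ?_⟩
    · rw [Matrix.SpecialLinearGroup.coe_mul, Matrix.transpose_mul]
      calc _ = (h : Matrix (Idx d) (Idx d) ℝ)ᵀ * ((g : Matrix (Idx d) (Idx d) ℝ)ᵀ * lorentz d *
            (g : Matrix (Idx d) (Idx d) ℝ)) * (h : Matrix (Idx d) (Idx d) ℝ) := by
            simp only [Matrix.mul_assoc]
        _ = _ := by rw [hg, hh]
    · rw [Matrix.SpecialLinearGroup.coe_mul, ← Matrix.mulVec_mulVec]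
      exact hg' _ (hh' _ hx)
  inv_mem' := by
    rintro g ⟨hg, hg'⟩
    have h1 : (g : Matrix (Idx d) (Idx d) ℝ) * (g⁻¹ : Matrix.SpecialLinearGroup (Idx d) ℝ) = 1 := by
      rw [← Matrix.SpecialLinearGroup.coe_mul, mul_inv_cancel, Matrix.SpecialLinearGroup.coe_one]
    have h2 : ((g⁻¹ : Matrix.SpecialLinearGroup (Idx d) ℝ) : Matrix (Idx d) (Idx d) ℝ)ᵀ * lorentz d *
        ((g⁻¹ : Matrix.SpecialLinearGroup (Idx d) ℝ) : Matrix (Idx d) (Idx d) ℝ) = lorentz d := by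
      set h : Matrix (Idx d) (Idx d) ℝ := ((g⁻¹ : Matrix.SpecialLinearGroup (Idx d) ℝ) :
        Matrix (Idx d) (Idx d) ℝ)
      calc hᵀ * lorentz d * h = ((g : Matrix (Idx d) (Idx d) ℝ) * h)ᵀ * lorentz d *
            ((g : Matrix (Idx d) (Idx d) ℝ) * h) := by
            conv_lhs => rw [← hg]
            simp only [Matrix.transpose_mul, Matrix.mul_assoc]
        _ = lorentz d := by rw [h1]; simp
    refine ⟨h2, fun x hx => ?_⟩
    set y := ((g⁻¹ : Matrix.SpecialLinearGroup (Idx d) ℝ) : Matrix (Idx d) (Idx d) ℝ) *ᵥ x with hy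
    have hgy : (g : Matrix (Idx d) (Idx d) ℝ) *ᵥ y = x := by
      rw [hy, Matrix.mulVec_mulVec, h1, Matrix.one_mulVec]
    have hq : y ⬝ᵥ (lorentz d *ᵥ y) = -1 := (lorentz_mulVec h2 x x).trans hx.1
    refine ⟨hq, ?_⟩
    by_contra hneg
    have hne : y (Sum.inr 1) ≠ 0 := by
      intro h0
      rw [lorentz_quad, h0] at hq
      have : 0 ≤ ∑ i, y (Sum.inl i) * y (Sum.inl i) :=
        Finset.sum_nonneg fun i _ => mul_self_nonneg _
      nlinarith [mul_self_nonneg (y (Sum.inr 0))]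
    have hmem : -y ∈ hyperboloid d := by
      refine ⟨by simpa [Matrix.mulVec_neg] using hq, ?_⟩
      have := lt_of_le_of_ne (not_lt.1 hneg) hne
      simpa using this
    have := (hg' _ hmem).2
    rw [Matrix.mulVec_neg, hgy] at this
    have h3 := hx.2
    simp at this
    linarith

/-- The matrix of an element of `G`. -/
def mat {d : ℕ} (g : G d) : Matrix (Idx d) (Idx d) ℝ :=
  ((g : Matrix.SpecialLinearGroup (Idx d) ℝ) : Matrix (Idx d) (Idx d) ℝ)

lemma mat_injective {d : ℕ} : Function.Injective (mat (d := d)) := fun _ _ h =>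
  Subtype.ext (Subtype.ext h)

lemma mat_mul {d : ℕ} (g h : G d) : mat (g * h) = mat g * mat h := by simp [mat]

lemma mat_one {d : ℕ} : mat (1 : G d) = 1 := by simp [mat]

lemma continuous_mat {d : ℕ} : Continuous (mat (d := d)) :=
  continuous_subtype_val.comp continuous_subtype_val

lemma isEmbedding_mat {d : ℕ} : IsEmbedding (mat (d := d)) :=
  IsEmbedding.subtypeVal.comp IsEmbedding.subtypeVal

/-- The base point `o ∈ ℍ^{d+1}`. -/
def basePt (d : ℕ) : Idx d → ℝ := Pi.single (Sum.inr 1) 1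

/-- `K = SO(d+1)`, the stabilizer of `o` in `G`. -/
def K (d : ℕ) : Subgroup (G d) where
  carrier := {k | mat k *ᵥ basePt d = basePt d}
  one_mem' := by simp [mat_one]
  mul_mem' := by
    rintro g h (hg : _ = _) (hh : _ = _)
    change _ = _
    rw [mat_mul, ← Matrix.mulVec_mulVec, hh, hg]
  inv_mem' := by
    rintro g (hg : _ = _)
    change _ = _
    conv_lhs => rw [← hg]
    rw [Matrix.mulVec_mulVec, ← mat_mul, inv_mul_cancel, mat_one, Matrix.one_mulVec]

/-- The matrix of the boost `a_t`. -/
noncomputable def boostMat (d : ℕ) (t : ℝ) : Matrix (Idx d) (Idx d) ℝ :=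
  Matrix.fromBlocks 1 0 0 !![Real.cosh t, Real.sinh t; Real.sinh t, Real.cosh t]

/-- A criterion for membership in `G`. -/
lemma mem_G_of_pos {d : ℕ} {g : Matrix.SpecialLinearGroup (Idx d) ℝ}
    (h1 : (g : Matrix (Idx d) (Idx d) ℝ)ᵀ * lorentz d * (g : Matrix (Idx d) (Idx d) ℝ) = lorentz d)
    (h2 : ∀ x ∈ hyperboloid d, 0 < ((g : Matrix (Idx d) (Idx d) ℝ) *ᵥ x) (Sum.inr 1) -
      ((g : Matrix (Idx d) (Idx d) ℝ) *ᵥ x) (Sum.inr 0)) : g ∈ G d := by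
  refine ⟨h1, fun x hx => ?_⟩
  have hq := (lorentz_mulVec h1 x x).trans hx.1
  refine ⟨hq, ?_⟩
  have h3 := h2 x hx
  set y := (g : Matrix (Idx d) (Idx d) ℝ) *ᵥ x
  rw [lorentz_quad] at hq
  have : 0 ≤ ∑ i, y (Sum.inl i) * y (Sum.inl i) :=
    Finset.sum_nonneg fun i _ => mul_self_nonneg _
  nlinarith

lemma hyperboloid_pos {d : ℕ} {x : Idx d → ℝ} (hx : x ∈ hyperboloid d) :
    0 < x (Sum.inr 1) - x (Sum.inr 0) := by
  obtain ⟨hq, h0⟩ := hx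
  rw [lorentz_quad] at hq
  have : 0 ≤ ∑ i, x (Sum.inl i) * x (Sum.inl i) :=
    Finset.sum_nonneg fun i _ => mul_self_nonneg _
  nlinarith

/-- The one-parameter subgroup `a_t` of `G`. -/
noncomputable def a (d : ℕ) (t : ℝ) : G d :=
  ⟨⟨boostMat d t, by
    rw [boostMat, Matrix.det_fromBlocks_one₁₁]
    simp [Matrix.det_fin_two_of]
    nlinarith [Real.cosh_sq t]⟩, by
    refine mem_G_of_pos ?_ fun x hx => ?_
    · simp only [boostMat, lorentz, Matrix.fromBlocks_transpose, Matrix.fromBlocks_multiply]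
      congr 1 <;> ext i j <;> simp
      have := Real.cosh_sq t
      fin_cases i <;> fin_cases j <;> simp [Matrix.mul_apply, Fin.sum_univ_two] <;> nlinarith
    · have h := hyperboloid_pos hx
      have : (boostMat d t *ᵥ x) (Sum.inr 1) - (boostMat d t *ᵥ x) (Sum.inr 0) =
          Real.exp (-t) * (x (Sum.inr 1) - x (Sum.inr 0)) := by
        have h3 := Real.cosh_sub_sinh t
        simp only [boostMat, Matrix.mulVec, dotProduct, Fintype.sum_sum_type, Fin.sum_univ_two]
        simp
        rw [← h3]
        ring
      rw [Matrix.SpecialLinearGroup.coe_mk, this]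
      positivity⟩

/-- `M = SO(d)`, the centralizer of `A = {a_t}` in `K`. -/
def M (d : ℕ) : Subgroup (K d) where
  carrier := {m | ∀ t, (m : G d) * a d t = a d t * (m : G d)}
  one_mem' := by simp
  mul_mem' := by
    intro m n hm hn t
    rw [Subgroup.coe_mul, mul_assoc, hn t, ← mul_assoc, hm t, mul_assoc]
  inv_mem' := by
    intro m hm t
    rw [Subgroup.coe_inv, inv_mul_eq_iff_eq_mul, ← mul_assoc, hm t, mul_assoc, mul_inv_cancel,
      mul_one]

lemma a_mul (d : ℕ) (t u : ℝ) : a d t * a d u = a d (t + u) := by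
  apply mat_injective
  rw [mat_mul]
  simp only [mat, a, boostMat, Matrix.SpecialLinearGroup.coe_mk, Matrix.fromBlocks_multiply]
  congr 1 <;> ext i j <;> simp
  fin_cases i <;> fin_cases j <;>
    simp [Matrix.mul_apply, Fin.sum_univ_two, Real.cosh_add, Real.sinh_add] <;> ring

lemma a_zero (d : ℕ) : a d 0 = 1 := by
  have := a_mul d 0 0
  simpa using this

lemma a_neg (d : ℕ) (t : ℝ) : a d (-t) = (a d t)⁻¹ :=
  eq_inv_of_mul_eq_one_left (by rw [a_mul, neg_add_cancel, a_zero])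

/-- The horospherical subgroup `N = {g | a_{-t} g a_t → e as t → +∞}`. -/
def N (d : ℕ) : Subgroup (G d) where
  carrier := {g | Tendsto (fun t : ℝ => a d (-t) * g * a d t) atTop (𝓝 1)}
  one_mem' := by
    simp [a_neg]
  mul_mem' := by
    intro g h (hg : Tendsto _ _ _) (hh : Tendsto _ _ _)
    have := hg.mul hh
    rw [mul_one] at this
    refine this.congr fun t => ?_
    rw [a_neg]
    group
  inv_mem' := by
    intro g (hg : Tendsto _ _ _)
    have := hg.inv
    rw [inv_one] at this
    refine this.congr fun t => ?_
    rw [a_neg]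
    group

/-! #### The Iwasawa decomposition -/

/-- The unipotent matrix with parameter `x ∈ ℝ^d`. -/
noncomputable def unipMat {d : ℕ} (x : Fin d → ℝ) : Matrix (Idx d) (Idx d) ℝ :=
  Matrix.fromBlocks 1 (Matrix.of fun i => ![-x i, x i]) (Matrix.of fun _ i => x i)
    !![1 - (∑ i, x i * x i) / 2, (∑ i, x i * x i) / 2;
      -((∑ i, x i * x i) / 2), 1 + (∑ i, x i * x i) / 2]

/-- The element of `G` with matrix `unipMat x`. -/
noncomputable def unip {d : ℕ} (x : Fin d → ℝ) : G d :=
  ⟨⟨unipMat x, by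
    rw [unipMat, Matrix.det_fromBlocks_one₁₁]
    simp [Matrix.det_fin_two, Matrix.mul_apply]
    ring⟩, by
    refine mem_G_of_pos ?_ fun y hy => ?_
    · simp only [unipMat, lorentz, Matrix.fromBlocks_transpose, Matrix.fromBlocks_multiply]
      congr 1 <;> ext i j
      · simp [Matrix.mul_apply, Fin.sum_univ_two]
      · fin_cases j <;> simp [Matrix.mul_apply, Fin.sum_univ_two, Matrix.one_apply] <;> ring
      · fin_cases i <;> simp [Matrix.mul_apply, Fin.sum_univ_two, Matrix.one_apply] <;> ring
      · fin_cases i <;> fin_cases j <;>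
          simp [Matrix.mul_apply, Fin.sum_univ_two, Matrix.one_apply] <;> ring
    · have h := hyperboloid_pos hy
      have : (unipMat x *ᵥ y) (Sum.inr 1) - (unipMat x *ᵥ y) (Sum.inr 0) =
          y (Sum.inr 1) - y (Sum.inr 0) := by
        simp [unipMat, Matrix.mulVec, dotProduct, Fin.sum_univ_two]
        ring
      rw [Matrix.SpecialLinearGroup.coe_mk, this]
      exact h⟩

lemma conj_unip {d : ℕ} (x : Fin d → ℝ) (t : ℝ) :
    a d (-t) * unip x * a d t = unip (Real.exp (-t) • x) := by
  rw [a_neg, mul_assoc, inv_mul_eq_iff_eq_mul]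
  apply mat_injective
  rw [mat_mul, mat_mul]
  have h3 := Real.cosh_sub_sinh t
  have h4 := Real.cosh_sq t
  have h5 : ∑ i, (Real.exp (-t) • x) i * (Real.exp (-t) • x) i =
      (Real.cosh t - Real.sinh t) ^ 2 * ∑ i, x i * x i := by
    rw [Finset.mul_sum, h3]
    exact Finset.sum_congr rfl fun i _ => by simp; ring
  simp only [mat, a, unip, boostMat, unipMat, Matrix.SpecialLinearGroup.coe_mk,
    Matrix.fromBlocks_multiply, h5]
  set R := ∑ i, x i * x i
  have h6 : ∀ i, (Real.exp (-t) • x) i = (Real.cosh t - Real.sinh t) * x i := by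
    intro i; simp [h3]
  simp only [h6]
  congr 1 <;> ext i j
  · simp
  · fin_cases j <;> simp [Matrix.mul_apply, Fin.sum_univ_two, Matrix.one_apply, -Real.cosh_sub_sinh]
      <;> ring
  · fin_cases i <;>
      simp [Matrix.mul_apply, Fin.sum_univ_two, Matrix.vecHead, Matrix.vecTail, -Real.cosh_sub_sinh]
      <;> linear_combination (-x j) * h4
  · fin_cases i <;> fin_cases j <;>
      simp [Matrix.mul_apply, Fin.sum_univ_two, -Real.cosh_sub_sinh] <;>
      first
        | linear_combination (R / 2 * (Real.cosh t - Real.sinh t)) * h4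
        | linear_combination (-(R / 2 * (Real.cosh t - Real.sinh t))) * h4

lemma unip_mem_N {d : ℕ} (x : Fin d → ℝ) : unip x ∈ N d := by
  change Tendsto _ _ _
  simp only [conj_unip]
  have hc : Continuous fun x : Fin d → ℝ => unip x := by
    rw [isEmbedding_mat.continuous_iff]
    refine Continuous.matrix_fromBlocks continuous_const ?_ ?_ ?_
    · refine continuous_matrix fun i j => ?_
      fin_cases j <;> simp <;> fun_prop
    · refine continuous_matrix fun i j => ?_
      simp; fun_prop
    · refine continuous_matrix fun i j => ?_
      fin_cases i <;> fin_cases j <;> simp <;> fun_prop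
  have h0 : unip (0 : Fin d → ℝ) = 1 := by
    apply mat_injective
    rw [mat_one]
    simp only [mat, unip, unipMat, Matrix.SpecialLinearGroup.coe_mk]
    rw [← Matrix.fromBlocks_one]
    congr 1 <;> ext i j
    · fin_cases j <;> simp
    · fin_cases i <;> fin_cases j <;> simp
  rw [← h0]
  refine (hc.tendsto 0).comp ?_
  have : Tendsto (fun t : ℝ => Real.exp (-t) • x) atTop (𝓝 ((0 : ℝ) • x)) :=
    (Real.tendsto_exp_neg_atTop_nhds_zero).smul_const x
  simpa using this

/-- The Iwasawa decomposition `G = KAN`. -/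
theorem iwasawa {d : ℕ} (g : G d) : ∃ (k : K d) (t : ℝ) (n : N d), g = k * a d t * n := by
  set p : Idx d → ℝ := mat g⁻¹ *ᵥ basePt d with hp
  have hbase : basePt d ∈ hyperboloid d := by
    refine ⟨?_, by simp [basePt]⟩
    rw [lorentz_quad]; simp [basePt]
  have hpH : p ∈ hyperboloid d := (g⁻¹).2.2 _ hbase
  have hpos := hyperboloid_pos hpH
  set u := p (Sum.inr 1) - p (Sum.inr 0) with hu
  set t := -Real.log u with ht
  set x : Fin d → ℝ := fun i => p (Sum.inl i) / u with hx
  have hq := hpH.1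
  rw [lorentz_quad] at hq
  have key : mat (unip x * a d t) *ᵥ basePt d = p := by
    have hc : Real.cosh t = (u + u⁻¹) / 2 := by
      rw [ht, Real.cosh_neg, Real.cosh_log hpos]
    have hs : Real.sinh t = (u⁻¹ - u) / 2 := by
      rw [ht, Real.sinh_neg, Real.sinh_log hpos]; ring
    have hxx : ∑ i, x i * x i = (∑ i, p (Sum.inl i) * p (Sum.inl i)) / u ^ 2 := by
      rw [Finset.sum_div]
      exact Finset.sum_congr rfl fun i _ => by rw [hx]; field_simp
    have hu0 : u ≠ 0 := hpos.ne'
    set S := ∑ i, p (Sum.inl i) * p (Sum.inl i)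
    have hS : S = u * (p (Sum.inr 1) + p (Sum.inr 0)) - 1 := by rw [hu]; linarith
    have ho : basePt d = Sum.elim (0 : Fin d → ℝ) ![(0 : ℝ), 1] := by
      ext i
      rcases i with i | i
      · simp [basePt]
      · fin_cases i <;> simp [basePt]
    rw [mat_mul, ← Matrix.mulVec_mulVec, ho]
    simp only [mat, a, unip, boostMat, unipMat, Matrix.SpecialLinearGroup.coe_mk,
      Matrix.fromBlocks_mulVec, hxx, hc, hs]
    ext i
    rcases i with i | i
    · simp [Matrix.mulVec, dotProduct, Fin.sum_univ_two, hx]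
      field_simp
      ring
    · fin_cases i
      · simp [Matrix.mulVec, dotProduct, Fin.sum_univ_two, hS]
        field_simp
        rw [hu]
        ring
      · simp [Matrix.mulVec, dotProduct, Fin.sum_univ_two, hS]
        field_simp
        rw [hu]
        ring
  have hk : g * (unip x * a d t) ∈ K d := by
    change _ = _
    rw [mat_mul, ← Matrix.mulVec_mulVec, key, hp, Matrix.mulVec_mulVec, ← mat_mul,
      mul_inv_cancel, mat_one, Matrix.one_mulVec]
  refine ⟨⟨_, hk⟩, -t, (⟨unip x, unip_mem_N x⟩ : N d)⁻¹, ?_⟩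
  simp only [Subgroup.coe_inv, a_neg]
  group

/-- The `K`-component `κ(g)` of `g = κ(g) exp(H(g)) n_g`. -/
noncomputable def kappa {d : ℕ} (g : G d) : K d := (iwasawa g).choose

/-- The real number `α(H(g))`, where `g = κ(g) exp(H(g)) n_g`; that is, `exp(H(g)) = a_{H g}`. -/
noncomputable def H {d : ℕ} (g : G d) : ℝ := (iwasawa g).choose_spec.choose

/-! #### Compactness of `K` and `M` -/

instance (d : ℕ) : MeasurableSpace (K d) := borel _

instance (d : ℕ) : BorelSpace (K d) := ⟨rfl⟩

/-- The matrices of the elements of `K`. -/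
lemma range_mat_K (d : ℕ) : Set.range (fun k : K d => mat (k : G d)) =
    {g | g.det = 1 ∧ gᵀ * lorentz d * g = lorentz d ∧ g *ᵥ basePt d = basePt d} := by
  ext g
  constructor
  · rintro ⟨k, rfl⟩
    exact ⟨k.1.1.2, k.1.2.1, k.2⟩
  · rintro ⟨h1, h2, h3⟩
    have hG : (⟨g, h1⟩ : Matrix.SpecialLinearGroup (Idx d) ℝ) ∈ G d := by
      refine ⟨h2, fun x hx => ⟨(lorentz_mulVec h2 x x).trans hx.1, ?_⟩⟩
      have h4 := lorentz_mulVec h2 x (basePt d)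
      rw [h3, lorentz_quad, lorentz_quad] at h4
      simp [basePt] at h4
      rw [Matrix.SpecialLinearGroup.coe_mk, h4]
      exact hx.2
    exact ⟨⟨⟨⟨g, h1⟩, hG⟩, h3⟩, rfl⟩

instance (d : ℕ) : CompactSpace (K d) := by
  have hemb : IsEmbedding (fun k : K d => mat (k : G d)) :=
    isEmbedding_mat.comp IsEmbedding.subtypeVal
  have hS : IsCompact (Set.range (fun k : K d => mat (k : G d))) := by
    rw [range_mat_K]
    refine IsCompact.of_isClosed_subset
      (s := (Set.univ.pi fun _ => Set.univ.pi fun _ => Set.Icc (-1 : ℝ) 1))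
      (isCompact_univ_pi fun _ => isCompact_univ_pi fun _ => isCompact_Icc) ?_ ?_
    · refine IsClosed.inter ?_ (IsClosed.inter ?_ ?_)
      · exact isClosed_eq (by fun_prop) continuous_const
      · exact isClosed_eq (by fun_prop) continuous_const
      · exact isClosed_eq (by fun_prop) continuous_const
    · rintro (g : Matrix (Idx d) (Idx d) ℝ) ⟨-, h2, h3⟩
      have hgs : ∀ i j, (g *ᵥ Pi.single j 1) i = g i j := fun i j => by simp
      have hlast : ∀ j, g (Sum.inr 1) j = (1 : Matrix (Idx d) (Idx d) ℝ) (Sum.inr 1) j := by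
        intro j
        have h4 := lorentz_mulVec h2 (Pi.single j 1) (basePt d)
        rw [h3, lorentz_quad, lorentz_quad] at h4
        simp only [hgs] at h4
        simp [basePt] at h4
        rw [h4, Pi.single_apply, Matrix.one_apply]
      have hcol : ∀ j, (∑ i, g (Sum.inl i) j * g (Sum.inl i) j) +
          g (Sum.inr 0) j * g (Sum.inr 0) j ≤ 1 := by
        intro j
        have h4 := lorentz_mulVec h2 (Pi.single j 1) (Pi.single j 1)
        rw [lorentz_quad, lorentz_quad] at h4
        simp only [hgs, hlast] at h4
        rcases j with j | j
        · simp [Pi.single_apply] at h4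
          linarith
        · fin_cases j
          · simp [Matrix.one_apply] at h4 ⊢
            linarith
          · simp [Matrix.one_apply] at h4 ⊢
            linarith
      intro i _ j _
      change -1 ≤ g i j ∧ g i j ≤ 1
      rw [← abs_le, ← sq_le_one_iff_abs_le_one]
      have hpos : ∀ i, 0 ≤ g (Sum.inl i) j * g (Sum.inl i) j := fun i => mul_self_nonneg _
      rcases i with i | i
      · have := Finset.single_le_sum (fun i _ => hpos i) (Finset.mem_univ i)
        nlinarith [hcol j, mul_self_nonneg (g (Sum.inr 0) j)]
      · fin_cases i
        · have := Finset.sum_nonneg fun i (_ : i ∈ Finset.univ) => hpos i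
          simp only [Fin.zero_eta]
          nlinarith [hcol j]
        · simp only [Fin.mk_one]
          rw [hlast, Matrix.one_apply]
          split_ifs <;> simp
  exact ⟨hemb.isCompact_iff.2 (by rwa [Set.image_univ])⟩

instance (d : ℕ) : CompactSpace (M d) := by
  have : IsClosed ((M d : Subgroup (K d)) : Set (K d)) := by
    have : ((M d : Subgroup (K d)) : Set (K d)) =
        ⋂ t, {m : K d | (m : G d) * a d t = a d t * (m : G d)} := by
      ext m; simp [M]
    rw [this]
    exact isClosed_iInter fun t => isClosed_eq (by fun_prop) (by fun_prop)
  exact this.isClosedEmbedding_subtypeVal.compactSpace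

end Group
/-! ### Complementary series -/

section Series

variable {d : ℕ}

open Classical in
/-- The standard representation `U^s` of `G` on `L²(K)`,
`[U^s(g) v](k) = e^{-s H(g⁻¹ k)} v(κ(g⁻¹ k))`. (The function on the right is always square
integrable, so that the alternative `0` never occurs.) -/
noncomputable def Us (s : ℂ) (g : G d) (v : L2 (K d)) : L2 (K d) :=
  if h : MemLp (fun k : K d => Complex.exp (-s * (H (g⁻¹ * (k : G d)) : ℂ)) *
      v (kappa (g⁻¹ * (k : G d)))) 2 (haarProb (K d))
  then h.toLp else 0

/-- `U ⊆ L²(K)` is a model `𝒰(υ, s)` of a complementary series representation of `G`: the number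
`s` lies in `(d/2, d)`, and `U` is an irreducible, unitarizable subrepresentation of
`(U^s, L²(K : υ))`. -/
structure IsComplementarySeries (υ : UnitaryIrrep (M d)) (s : ℝ) (U : Submodule ℂ (L2 (K d))) :
    Prop where
  half_lt : (d : ℝ) / 2 < s
  lt_dim : s < d
  isClosed : IsClosed (U : Set (L2 (K d)))
  subset_rightIsotypic : (U : Set (L2 (K d))) ⊆ rightIsotypic υ
  invariant : ∀ g : G d, ∀ v ∈ U, Us s g v ∈ U
  ne_bot : U ≠ ⊥
  irreducible : ∀ W : Submodule ℂ (L2 (K d)), IsClosed (W : Set (L2 (K d))) → W ≤ U →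
    (∀ g : G d, ∀ v ∈ W, Us s g v ∈ W) → W = ⊥ ∨ W = U
  /-- There is a `U^s(G)`-invariant (continuous) inner product `B` on `U`. -/
  unitarizable : ∃ B : L2 (K d) →L⋆[ℂ] L2 (K d) →L[ℂ] ℂ,
    (∀ v ∈ U, ∀ w ∈ U, B v w = conj (B w v)) ∧
    (∀ v ∈ U, v ≠ 0 → 0 < (B v v).re) ∧
    ∀ g : G d, ∀ v ∈ U, ∀ w ∈ U, B (Us s g v) (Us s g w) = B v w

/-- `τ` is a `K`-type of `U`, that is, `U_τ ≠ 0`. -/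
def IsKType (τ : UnitaryIrrep (K d)) (U : Submodule ℂ (L2 (K d))) : Prop :=
  isotypic τ U ≠ ⊥

/-- The operator `T_{τ₁}^{τ₂} : U_{τ₁} → U_{τ₂}`, `T v = ∫_M v(m) U^s(m) χ_{τ₂} dm`. (The formula
does not involve `τ₁`; it is applied to `v ∈ U_{τ₁}`, whose elements are continuous functions.) -/
noncomputable def eisT (s : ℂ) (U : Submodule ℂ (L2 (K d))) (τ₂ : UnitaryIrrep (K d))
    (v : L2 (K d)) : L2 (K d) :=
  ∫ m : M d, contRep v (m : K d) • Us s ((m : K d) : G d) (evalVec τ₂ U) ∂(haarProb (M d))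

end Series

end Eisenstein

/-! The formula is a reproducing-kernel identity followed by a change of variables. Write `λ` for
the left regular representation, which is `U^s` on `K`. The vector `evalVec τ U` represents
evaluation at `e` on `U_τ`, so its translates by `λ(x)` represent evaluation at `x`. Since `P_τ` is
self-adjoint and maps the closed invariant space `U` into `U_τ`, it follows that `P_τ W = ∫ W(x)
λ(x) χ_τ dx` for every continuous `W ∈ U` (`isoProj_toLp_eq_integral`).

Take `W = U^s(g) f` with `f ∈ U_{τ₁}` and substitute `x = κ(gk)`. The Jacobian is `e^{-d H(gk)}`
(`integral_kappa_mul`). The cocycle identities give `κ(g⁻¹ κ(gk)) = k` and `H(g⁻¹ κ(gk)) = -H(gk)`,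
so the factor `e^{-sH}` becomes `e^{s H(gk)}`. The result is `∫ e^{(s-d)H(gk)} f(k) λ(κ(gk)) χ_{τ₂}
dk` (`isoProj_Us_toLp_eq_integral`).

Finally `k` is replaced by `km` and averaged over `m ∈ M`. Because `H(gkm) = H(gk)` and `κ(gkm) =
κ(gk) m`, the inner integral is `λ(κ(gk))` applied to `T λ(k⁻¹) f` (`integral_M_eq`). All integrands
are continuous on compact groups, whence the absolute convergence.

Two ingredients need real work. The Jacobian comes from the unimodularity of `G`: in the coordinates
`k p⁻¹`, with `p ∈ AN`, Haar measure of `G` is a product, and left translation by `g` acts on the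
second factor by a right translation, which scales the left Haar measure of `AN` by its modulus. The
properties of `P_τ` come from Schur orthogonality. Since `kappa` and `H` are defined by choice,
uniqueness and continuity of the Iwasawa decomposition must be established beforehand. -/

namespace Eisenstein

open MeasureTheory Matrix Filter Topology
open scoped ENNReal ComplexConjugate

/-! ### Uniqueness and continuity of the Iwasawa decomposition -/

section Iwasawa

variable {d : ℕ}

/-- The light-like vector fixed by `N` and scaled by `A`. -/
def lightVec (d : ℕ) : Idx d → ℝ := Sum.elim 0 ![1, 1]

lemma mat_mul_mulVec (g h : G d) (x : Idx d → ℝ) :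
    mat (g * h) *ᵥ x = mat g *ᵥ (mat h *ᵥ x) := by
  rw [mat_mul, Matrix.mulVec_mulVec]

lemma mat_a_mulVec_inl (t : ℝ) (y : Idx d → ℝ) (i : Fin d) :
    (mat (a d t) *ᵥ y) (Sum.inl i) = y (Sum.inl i) := by
  simp [mat, a, boostMat, Matrix.mulVec, dotProduct, Matrix.one_apply]

lemma mat_a_mulVec_zero (t : ℝ) (y : Idx d → ℝ) :
    (mat (a d t) *ᵥ y) (Sum.inr 0) =
      Real.cosh t * y (Sum.inr 0) + Real.sinh t * y (Sum.inr 1) := by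
  simp [mat, a, boostMat, Matrix.mulVec, dotProduct, Fin.sum_univ_two]

lemma mat_a_mulVec_one (t : ℝ) (y : Idx d → ℝ) :
    (mat (a d t) *ᵥ y) (Sum.inr 1) =
      Real.sinh t * y (Sum.inr 0) + Real.cosh t * y (Sum.inr 1) := by
  simp [mat, a, boostMat, Matrix.mulVec, dotProduct, Fin.sum_univ_two]

lemma mat_a_mulVec_lightVec (t : ℝ) :
    mat (a d t) *ᵥ lightVec d = Real.exp t • lightVec d := by
  ext i
  rcases i with i | i
  · simp [mat_a_mulVec_inl, lightVec]
  · fin_cases i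
    · simp [mat_a_mulVec_zero, lightVec, Real.cosh_add_sinh]
    · simp [mat_a_mulVec_one, lightVec, Real.sinh_add_cosh]

lemma eq_zero_of_tendsto_exp_mul {z w : ℝ}
    (h : Tendsto (fun t : ℝ => Real.exp t * z) atTop (𝓝 w)) : z = 0 := by
  have h1 := Real.tendsto_exp_neg_atTop_nhds_zero.mul h
  rw [zero_mul] at h1
  refine tendsto_nhds_unique (tendsto_const_nhds.congr fun t => ?_) h1
  rw [← mul_assoc, ← Real.exp_add]
  simp

/-- `N` is defined dynamically, so no matrix form of `n` is at hand. Let `ξ` be the light-like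
vector and `y = nξ`. Applying `a_{-t} n a_t → e` to `ξ`, which `a_t` scales by `e^t`, gives `e^t
a_{-t} y → ξ`. On the left the first `d` coordinates grow like `e^t`, the difference of the last two
like `e^{2t}`, and their sum is constant. The first two must therefore vanish, and the sum equals
`2`. -/
lemma mat_mulVec_lightVec_of_mem_N {n : G d} (hn : n ∈ N d) :
    mat n *ᵥ lightVec d = lightVec d := by
  set y := mat n *ᵥ lightVec d with hy
  have hn : Tendsto (fun t : ℝ => a d (-t) * n * a d t) atTop (𝓝 1) := hn
  have hc : Continuous fun g : G d => mat g *ᵥ lightVec d :=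
    continuous_mat.matrix_mulVec continuous_const
  have h1 := (hc.tendsto 1).comp hn
  have h2 : ∀ t : ℝ, mat (a d (-t) * n * a d t) *ᵥ lightVec d =
      Real.exp t • (mat (a d (-t)) *ᵥ y) := by
    intro t
    rw [mat_mul_mulVec, mat_a_mulVec_lightVec, Matrix.mulVec_smul, mat_mul_mulVec]
  simp only [Function.comp_def, h2, mat_one, Matrix.one_mulVec] at h1
  have h3 := tendsto_pi_nhds.1 h1
  have hl : ∀ i, y (Sum.inl i) = 0 := fun i =>
    eq_zero_of_tendsto_exp_mul (by simpa [mat_a_mulVec_inl] using h3 (Sum.inl i))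
  have hexp : ∀ t : ℝ, Real.cosh t + Real.sinh t = Real.exp t := Real.cosh_add_sinh
  have hsub : y (Sum.inr 1) - y (Sum.inr 0) = 0 := by
    have h4 := (h3 (Sum.inr 1)).sub (h3 (Sum.inr 0))
    have h5 := Real.tendsto_exp_neg_atTop_nhds_zero.mul h4
    refine eq_zero_of_tendsto_exp_mul (h5.congr fun t => ?_)
    simp only [Pi.smul_apply, smul_eq_mul, mat_a_mulVec_zero, mat_a_mulVec_one, Real.cosh_neg,
      Real.sinh_neg]
    have h6 : Real.exp (-t) * Real.exp t = 1 := by rw [← Real.exp_add]; simp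
    rw [← hexp t]
    rw [← hexp t] at h6
    linear_combination (Real.cosh t + Real.sinh t) * (y (Sum.inr 1) - y (Sum.inr 0)) * h6
  have hadd : y (Sum.inr 1) + y (Sum.inr 0) = 2 := by
    have h4 := (h3 (Sum.inr 1)).add (h3 (Sum.inr 0))
    refine tendsto_nhds_unique (tendsto_const_nhds.congr fun t => ?_)
      (h4.trans (by simp [lightVec]; norm_num))
    simp only [Pi.smul_apply, smul_eq_mul, mat_a_mulVec_zero, mat_a_mulVec_one, Real.cosh_neg,
      Real.sinh_neg]
    rw [← hexp t]
    linear_combination (-(y (Sum.inr 1) + y (Sum.inr 0))) * Real.cosh_sq_sub_sinh_sq t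
  ext i
  rcases i with i | i
  · simp [hl, lightVec]
  · fin_cases i
    · simp [lightVec]; linarith
    · simp [lightVec]; linarith

/-- Up to sign, the time coordinate is the Lorentz product with the base point, which `K` fixes. -/
lemma mat_mulVec_time_of_mem_K {k : G d} (hk : k ∈ K d) (x : Idx d → ℝ) :
    (mat k *ᵥ x) (Sum.inr 1) = x (Sum.inr 1) := by
  have h4 := lorentz_mulVec k.2.1 x (basePt d)
  have hk : mat k *ᵥ basePt d = basePt d := hk
  rw [show ((k : Matrix.SpecialLinearGroup (Idx d) ℝ) : Matrix (Idx d) (Idx d) ℝ) = mat k from rfl,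
    hk, lorentz_quad, lorentz_quad] at h4
  simpa [basePt] using h4

/-- An element of `K ∩ N` fixes the base point and the light-like vector, hence the whole plane in
which `A` acts, and so it commutes with `A`. Then `a_{-t} n a_t` is constantly `n`, while it tends
to `e`. -/
lemma eq_one_of_mem_K_of_mem_N {n : G d} (hK : n ∈ K d) (hN : n ∈ N d) : n = 1 := by
  have hK' : mat n *ᵥ basePt d = basePt d := hK
  have hx := mat_mulVec_lightVec_of_mem_N hN
  set e0 : Idx d → ℝ := Pi.single (Sum.inr 0) 1 with he0
  have h0 : mat n *ᵥ e0 = e0 := by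
    have : e0 = lightVec d - basePt d := by
      ext i
      rcases i with i | i
      · simp [he0, lightVec, basePt]
      · fin_cases i <;> simp [he0, lightVec, basePt]
    rw [this, Matrix.mulVec_sub, hK', hx]
  have hr0 : ∀ x : Idx d → ℝ, (mat n *ᵥ x) (Sum.inr 0) = x (Sum.inr 0) := by
    intro x
    have h4 := lorentz_mulVec n.2.1 x e0
    rw [show ((n : Matrix.SpecialLinearGroup (Idx d) ℝ) : Matrix (Idx d) (Idx d) ℝ) = mat n from rfl,
      h0, lorentz_quad, lorentz_quad] at h4
    simpa [he0] using h4
  have hsplit : ∀ x : Idx d → ℝ, x = Sum.elim (fun i => x (Sum.inl i)) 0 +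
      (x (Sum.inr 0) • e0 + x (Sum.inr 1) • basePt d) := by
    intro x
    ext i
    rcases i with i | i
    · simp [he0, basePt]
    · fin_cases i <;> simp [he0, basePt]
  have hcomm : ∀ t, n * a d t = a d t * n := by
    intro t
    apply mat_injective
    apply Matrix.mulVec_injective
    ext1 x
    rw [mat_mul_mulVec, mat_mul_mulVec]
    ext i
    rcases i with i | i
    · rw [mat_a_mulVec_inl, hsplit x, hsplit (mat (a d t) *ᵥ _)]
      simp only [Matrix.mulVec_add, Matrix.mulVec_smul, h0, hK', Pi.add_apply, mat_a_mulVec_inl]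
      simp [he0, basePt, mat_a_mulVec_inl]
    · fin_cases i
      · simp only [Fin.zero_eta, hr0, mat_a_mulVec_zero, mat_mulVec_time_of_mem_K hK]
      · simp only [Fin.mk_one, hr0, mat_a_mulVec_one, mat_mulVec_time_of_mem_K hK]
  have hN' : Tendsto (fun t : ℝ => a d (-t) * n * a d t) atTop (𝓝 1) := hN
  refine tendsto_nhds_unique (tendsto_const_nhds.congr fun t => ?_) hN'
  rw [mul_assoc, hcomm, ← mul_assoc, a_neg]
  simp

lemma conj_a_mem_N {n : G d} (hn : n ∈ N d) (u : ℝ) : a d u * n * a d (-u) ∈ N d := by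
  have hn : Tendsto (fun t : ℝ => a d (-t) * n * a d t) atTop (𝓝 1) := hn
  change Tendsto _ _ _
  have := (hn.const_mul (a d u)).mul_const (a d (-u))
  simp only [mul_one, a_mul, add_neg_cancel, a_zero] at this
  refine this.congr fun t => ?_
  have e1 : a d u * (a d (-t) * n * a d t) * a d (-u) =
      (a d u * a d (-t)) * n * (a d t * a d (-u)) := by group
  have e2 : a d (-t) * (a d u * n * a d (-u)) * a d t =
      (a d (-t) * a d u) * n * (a d (-u) * a d t) := by group
  rw [e1, e2, a_mul, a_mul, a_mul, a_mul, add_comm u, add_comm t]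

lemma conj_M_mem_N {n : G d} (hn : n ∈ N d) (m : M d) :
    (((m : K d) : G d))⁻¹ * n * ((m : K d) : G d) ∈ N d := by
  have hn : Tendsto (fun t : ℝ => a d (-t) * n * a d t) atTop (𝓝 1) := hn
  change Tendsto _ _ _
  have := (hn.const_mul ((m : K d) : G d)⁻¹).mul_const ((m : K d) : G d)
  simp only [mul_one, inv_mul_cancel] at this
  refine this.congr fun t => ?_
  have h1 := m.2 t
  have h2 : a d (-t) * ((m : K d) : G d)⁻¹ = ((m : K d) : G d)⁻¹ * a d (-t) := by
    have := m.2 (-t)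
    rw [eq_inv_mul_iff_mul_eq, ← mul_assoc, this]
    group
  calc _ = (((m : K d) : G d)⁻¹ * a d (-t)) * n * (a d t * ((m : K d) : G d)) := by group
    _ = _ := by rw [← h2, ← h1]; group

lemma iwasawa_eq (g : G d) : ∃ n ∈ N d, g = kappa g * a d (H g) * n :=
  ⟨_, (iwasawa g).choose_spec.choose_spec.choose.2, (iwasawa g).choose_spec.choose_spec.choose_spec⟩

/-- `N` fixes the light-like vector, `A` scales it and `K` preserves time coordinates. This
determines `t` from the product alone, so that `H` is independent of the chosen decomposition and is
given by a continuous formula. -/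
lemma mat_iwasawa_mulVec_lightVec_time {k n : G d} (hk : k ∈ K d) (hn : n ∈ N d) (t : ℝ) :
    (mat (k * a d t * n) *ᵥ lightVec d) (Sum.inr 1) = Real.exp t := by
  rw [mat_mul_mulVec, mat_mulVec_lightVec_of_mem_N hn, mat_mul_mulVec,
    mat_mulVec_time_of_mem_K hk, mat_a_mulVec_lightVec]
  simp [lightVec]

lemma exp_H (g : G d) : Real.exp (H g) = (mat g *ᵥ lightVec d) (Sum.inr 1) := by
  obtain ⟨n, hn, h⟩ := iwasawa_eq g
  conv_rhs => rw [h]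
  exact (mat_iwasawa_mulVec_lightVec_time (kappa g).2 hn _).symm

lemma H_eq_log (g : G d) : H g = Real.log ((mat g *ᵥ lightVec d) (Sum.inr 1)) := by
  rw [← exp_H, Real.log_exp]

lemma H_iwasawa (k : K d) (t : ℝ) {n : G d} (hn : n ∈ N d) : H ((k : G d) * a d t * n) = t := by
  rw [H_eq_log, mat_iwasawa_mulVec_lightVec_time k.2 hn, Real.log_exp]

/-- With the `A`-components already equal, the quotient of two candidates for the `K`-component is
an `A`-conjugate of an element of `N`, hence lies in `K ∩ N`. -/
lemma kappa_iwasawa (k : K d) (t : ℝ) {n : G d} (hn : n ∈ N d) :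
    kappa ((k : G d) * a d t * n) = k := by
  obtain ⟨n', hn', h⟩ := iwasawa_eq ((k : G d) * a d t * n)
  rw [H_iwasawa k t hn] at h
  set k' := kappa ((k : G d) * a d t * n)
  have h1 : ((k'⁻¹ * k : K d) : G d) = a d t * (n' * n⁻¹) * a d (-t) := by
    rw [a_neg, Subgroup.coe_mul, Subgroup.coe_inv, inv_mul_eq_iff_eq_mul]
    calc (k : G d) = (k * a d t * n) * n⁻¹ * (a d t)⁻¹ := by group
      _ = _ := by rw [h]; group
  have h2 := eq_one_of_mem_K_of_mem_N (k'⁻¹ * k).2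
    (h1 ▸ conj_a_mem_N ((N d).mul_mem hn' ((N d).inv_mem hn)) t)
  have h3 : k'⁻¹ * k = 1 := Subtype.ext h2
  rw [inv_mul_eq_one] at h3
  exact h3

lemma continuous_H : Continuous (H (d := d)) := by
  have : H (d := d) = fun g => Real.log ((mat g *ᵥ lightVec d) (Sum.inr 1)) := funext H_eq_log
  rw [this]
  refine Continuous.log ?_ fun g => ?_
  · exact continuous_pi_iff.1 (continuous_mat.matrix_mulVec continuous_const) (Sum.inr 1)
  · rw [← exp_H]; exact (Real.exp_pos _).ne'

lemma kappa_K_mul (k : K d) (g : G d) : kappa ((k : G d) * g) = k * kappa g := by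
  obtain ⟨n, hn, h⟩ := iwasawa_eq g
  conv_lhs => rw [h, ← mul_assoc, ← mul_assoc, ← Subgroup.coe_mul]
  exact kappa_iwasawa _ _ hn

lemma H_K_mul (k : K d) (g : G d) : H ((k : G d) * g) = H g := by
  obtain ⟨n, hn, h⟩ := iwasawa_eq g
  conv_lhs => rw [h, ← mul_assoc, ← mul_assoc, ← Subgroup.coe_mul]
  exact H_iwasawa _ _ hn

lemma kappa_one : kappa (1 : G d) = 1 := by
  simpa [a_zero] using kappa_iwasawa (d := d) 1 0 (N d).one_mem

lemma H_one : H (1 : G d) = 0 := by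
  simpa [a_zero] using H_iwasawa (d := d) 1 0 (N d).one_mem

lemma kappa_coe (k : K d) : kappa (k : G d) = k := by
  simpa [kappa_one] using kappa_K_mul k 1

lemma H_coe (k : K d) : H (k : G d) = 0 := by
  simpa [H_one] using H_K_mul k 1

/-- `A` normalizes `N`, so right multiplication by `AN` affects only the `A`- and `N`-components.
The cocycle identities `kappa_mul` and `H_mul` rest on this. -/
lemma mul_iwasawa_eq (g : G d) (t : ℝ) (n : G d) : ∃ n' ∈ N d, g * a d t * n =
    kappa g * a d (H g + t) * (n' * n) := by
  obtain ⟨n1, hn1, h⟩ := iwasawa_eq g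
  have h1 := conj_a_mem_N hn1 (-t)
  rw [neg_neg] at h1
  refine ⟨_, h1, ?_⟩
  conv_lhs => rw [h]
  rw [← a_mul, a_neg]
  group

lemma kappa_mul_AN (g : G d) (t : ℝ) {n : G d} (hn : n ∈ N d) :
    kappa (g * a d t * n) = kappa g := by
  obtain ⟨n', hn', h⟩ := mul_iwasawa_eq g t n
  rw [h]
  exact kappa_iwasawa _ _ ((N d).mul_mem hn' hn)

lemma H_mul_AN (g : G d) (t : ℝ) {n : G d} (hn : n ∈ N d) :
    H (g * a d t * n) = H g + t := by
  obtain ⟨n', hn', h⟩ := mul_iwasawa_eq g t n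
  rw [h]
  exact H_iwasawa _ _ ((N d).mul_mem hn' hn)

lemma kappa_mul (g h : G d) : kappa (g * h) = kappa (g * (kappa h : G d)) := by
  obtain ⟨n, hn, e⟩ := iwasawa_eq h
  conv_lhs => rw [e, ← mul_assoc, ← mul_assoc]
  exact kappa_mul_AN _ _ hn

lemma H_mul (g h : G d) : H (g * h) = H (g * (kappa h : G d)) + H h := by
  obtain ⟨n, hn, e⟩ := iwasawa_eq h
  conv_lhs => rw [e, ← mul_assoc, ← mul_assoc]
  exact H_mul_AN _ _ hn

/-- `M` centralizes `A` and normalizes `N`, so `m` can be moved to the left past both. This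
equivariance is what produces the integral over `M` in the final formula. -/
lemma mul_M_eq (g : G d) (m : M d) : ∃ n ∈ N d, g * ((m : K d) : G d) =
    ((kappa g * m : K d) : G d) * a d (H g) * n := by
  obtain ⟨n, hn, e⟩ := iwasawa_eq g
  refine ⟨_, conj_M_mem_N hn m, ?_⟩
  conv_lhs => rw [e]
  have h1 := m.2 (H g)
  rw [Subgroup.coe_mul, mul_assoc (kappa g : G d) ((m : K d) : G d), h1]
  group

lemma kappa_mul_M (g : G d) (m : M d) : kappa (g * ((m : K d) : G d)) = kappa g * m := by
  obtain ⟨n, hn, e⟩ := mul_M_eq g m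
  rw [e, kappa_iwasawa _ _ hn]

lemma H_mul_M (g : G d) (m : M d) : H (g * ((m : K d) : G d)) = H g := by
  obtain ⟨n, hn, e⟩ := mul_M_eq g m
  rw [e, H_iwasawa _ _ hn]

/-- The maps `k ↦ κ(gk)` define an action of `G` on `K`, so that of `g⁻¹` undoes that of `g`. -/
lemma kappa_inv_mul_kappa (g : G d) (k : K d) :
    kappa (g⁻¹ * (kappa (g * (k : G d)) : G d)) = k := by
  rw [← kappa_mul, inv_mul_cancel_left, kappa_coe]

lemma H_inv_mul_kappa (g : G d) (k : K d) :
    H (g⁻¹ * (kappa (g * (k : G d)) : G d)) = - H (g * (k : G d)) := by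
  have := H_mul g⁻¹ (g * (k : G d))
  rw [inv_mul_cancel_left, H_coe] at this
  linarith

end Iwasawa

/-! ### Horospherical coordinates -/

section Horospherical

variable {d : ℕ}

lemma basePt_eq_elim (d : ℕ) : basePt d = Sum.elim (0 : Fin d → ℝ) ![(0 : ℝ), 1] := by
  ext i
  rcases i with i | i
  · simp [basePt]
  · fin_cases i <;> simp [basePt]

lemma basePt_mem_hyperboloid (d : ℕ) : basePt d ∈ hyperboloid d := by
  refine ⟨?_, by simp [basePt]⟩
  rw [lorentz_quad]; simp [basePt]

/-- The element `n_x a_t` of `NA`, for `q = (t, x)`. -/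
noncomputable def horoElt (q : ℝ × (Fin d → ℝ)) : G d := unip q.2 * a d q.1

/-- The coordinates `(t, x)` of the point `n_x a_t o` of the hyperboloid. -/
noncomputable def horoCoord (y : Idx d → ℝ) : ℝ × (Fin d → ℝ) :=
  (-Real.log (y (Sum.inr 1) - y (Sum.inr 0)),
    fun i => y (Sum.inl i) / (y (Sum.inr 1) - y (Sum.inr 0)))

lemma mat_horoElt_mulVec_inl (q : ℝ × (Fin d → ℝ)) (i : Fin d) :
    (mat (horoElt q) *ᵥ basePt d) (Sum.inl i) = q.2 i * Real.exp (-q.1) := by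
  rw [horoElt, mat_mul, ← Matrix.mulVec_mulVec, basePt_eq_elim, ← Real.cosh_sub_sinh]
  simp only [mat, a, unip, boostMat, unipMat, Matrix.SpecialLinearGroup.coe_mk,
    Matrix.fromBlocks_mulVec]
  simp [Matrix.mulVec, dotProduct, Fin.sum_univ_two, -Real.cosh_sub_sinh]
  ring

lemma mat_horoElt_mulVec_sub (q : ℝ × (Fin d → ℝ)) :
    (mat (horoElt q) *ᵥ basePt d) (Sum.inr 1) - (mat (horoElt q) *ᵥ basePt d) (Sum.inr 0) =
      Real.exp (-q.1) := by
  rw [horoElt, mat_mul, ← Matrix.mulVec_mulVec, basePt_eq_elim, ← Real.cosh_sub_sinh]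
  simp only [mat, a, unip, boostMat, unipMat, Matrix.SpecialLinearGroup.coe_mk,
    Matrix.fromBlocks_mulVec]
  simp [Matrix.mulVec, dotProduct, Fin.sum_univ_two, -Real.cosh_sub_sinh]
  ring

lemma horoCoord_mat_horoElt (q : ℝ × (Fin d → ℝ)) :
    horoCoord (mat (horoElt q) *ᵥ basePt d) = q := by
  refine Prod.ext ?_ (funext fun i => ?_)
  · simp [horoCoord, mat_horoElt_mulVec_sub]
  · simp only [horoCoord, mat_horoElt_mulVec_sub, mat_horoElt_mulVec_inl]
    exact mul_div_cancel_right₀ _ (Real.exp_pos _).ne'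

/-- A point of the hyperboloid is determined by `y_d+1 - y_d` and the first `d` coordinates. -/
lemma hyperboloid_ext {y z : Idx d → ℝ} (hy : y ∈ hyperboloid d) (hz : z ∈ hyperboloid d)
    (h : y (Sum.inr 1) - y (Sum.inr 0) = z (Sum.inr 1) - z (Sum.inr 0))
    (h' : ∀ i, y (Sum.inl i) = z (Sum.inl i)) : y = z := by
  have hpos := hyperboloid_pos hz
  have h1 := hy.1
  have h2 := hz.1
  rw [lorentz_quad] at h1 h2
  simp only [h'] at h1
  have h3 : y (Sum.inr 1) + y (Sum.inr 0) = z (Sum.inr 1) + z (Sum.inr 0) := by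
    refine mul_left_cancel₀ hpos.ne' ?_
    linear_combination h2 - h1 - (y (Sum.inr 1) + y (Sum.inr 0)) * h
  ext i
  rcases i with i | i
  · exact h' i
  · fin_cases i
    · simp; linarith
    · simp; linarith

lemma mat_mulVec_mem_hyperboloid (g : G d) {y : Idx d → ℝ} (hy : y ∈ hyperboloid d) :
    mat g *ᵥ y ∈ hyperboloid d := g.2.2 y hy

/-- Together with `horoCoord_mat_horoElt`: the elements `n_x a_t` act simply transitively on
hyperbolic space. -/
lemma mat_horoElt_horoCoord {y : Idx d → ℝ} (hy : y ∈ hyperboloid d) :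
    mat (horoElt (horoCoord y)) *ᵥ basePt d = y := by
  have hpos := hyperboloid_pos hy
  have hexp : Real.exp (-(horoCoord y).1) = y (Sum.inr 1) - y (Sum.inr 0) := by
    simp [horoCoord, Real.exp_log hpos]
  refine hyperboloid_ext (mat_mulVec_mem_hyperboloid _ (basePt_mem_hyperboloid d)) hy ?_ fun i => ?_
  · rw [mat_horoElt_mulVec_sub, hexp]
  · rw [mat_horoElt_mulVec_inl, hexp, horoCoord]
    exact div_mul_cancel₀ _ hpos.ne'

lemma continuous_unip : Continuous fun x : Fin d → ℝ => unip x := by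
  rw [isEmbedding_mat.continuous_iff]
  refine Continuous.matrix_fromBlocks continuous_const ?_ ?_ ?_
  · refine continuous_matrix fun i j => ?_
    fin_cases j <;> simp <;> fun_prop
  · refine continuous_matrix fun i j => ?_
    simp; fun_prop
  · refine continuous_matrix fun i j => ?_
    fin_cases i <;> fin_cases j <;> simp <;> fun_prop

lemma continuous_a : Continuous (a d) := by
  rw [isEmbedding_mat.continuous_iff]
  refine Continuous.matrix_fromBlocks continuous_const continuous_const continuous_const ?_
  refine continuous_matrix fun i j => ?_
  fin_cases i <;> fin_cases j <;> simp <;> fun_prop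

lemma continuous_horoElt : Continuous (horoElt (d := d)) :=
  (continuous_unip.comp continuous_snd).mul (continuous_a.comp continuous_fst)

lemma continuous_horoCoord_mulVec :
    Continuous fun g : G d => horoCoord (mat g *ᵥ basePt d) := by
  have hc : ∀ i, Continuous fun g : G d => (mat g *ᵥ basePt d) i := fun i =>
    continuous_pi_iff.1 (continuous_mat.matrix_mulVec continuous_const) i
  have hpos : ∀ g : G d, (mat g *ᵥ basePt d) (Sum.inr 1) - (mat g *ᵥ basePt d) (Sum.inr 0) ≠ 0 :=
    fun g => (hyperboloid_pos (mat_mulVec_mem_hyperboloid g (basePt_mem_hyperboloid d))).ne'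
  refine Continuous.prodMk ?_ (continuous_pi fun i => ?_)
  · exact (((hc _).sub (hc _)).log hpos).neg
  · exact (hc _).div ((hc _).sub (hc _)) hpos

lemma unip_add (x y : Fin d → ℝ) : unip x * unip y = unip (x + y) := by
  apply mat_injective
  rw [mat_mul]
  have h : ∑ i, (x + y) i * (x + y) i =
      (∑ i, x i * x i) + 2 * (∑ i, x i * y i) + ∑ i, y i * y i := by
    rw [Finset.mul_sum, ← Finset.sum_add_distrib, ← Finset.sum_add_distrib]
    exact Finset.sum_congr rfl fun i _ => by simp; ring
  simp only [mat, unip, unipMat, Matrix.SpecialLinearGroup.coe_mk,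
    Matrix.fromBlocks_multiply, h]
  congr 1 <;> ext i j
  · simp [Matrix.mul_apply, Fin.sum_univ_two]
  · fin_cases j <;> simp [Matrix.mul_apply, Fin.sum_univ_two, Matrix.one_apply] <;> ring
  · fin_cases i <;> simp [Matrix.mul_apply, Fin.sum_univ_two, Matrix.vecHead, Matrix.vecTail]
      <;> ring
  · fin_cases i <;> fin_cases j <;>
      simp [Matrix.mul_apply, Fin.sum_univ_two, Matrix.one_apply] <;> ring

lemma a_mul_unip (u : ℝ) (x : Fin d → ℝ) : a d u * unip x = unip (Real.exp u • x) * a d u := by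
  have := conj_unip x (-u)
  rw [neg_neg] at this
  rw [← this, mul_assoc, a_mul, neg_add_cancel, a_zero, mul_one]

lemma unip_mul_horoElt (y : Fin d → ℝ) (q : ℝ × (Fin d → ℝ)) :
    unip y * horoElt q = horoElt (q.1, y + q.2) := by
  rw [horoElt, horoElt, ← mul_assoc, unip_add]

lemma a_mul_horoElt (u : ℝ) (q : ℝ × (Fin d → ℝ)) :
    a d u * horoElt q = horoElt (u + q.1, Real.exp u • q.2) := by
  rw [horoElt, horoElt, ← mul_assoc, a_mul_unip, mul_assoc, a_mul]

lemma horoElt_eq (q : ℝ × (Fin d → ℝ)) :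
    horoElt q = ((1 : K d) : G d) * a d q.1 * unip (Real.exp (-q.1) • q.2) := by
  rw [Subgroup.coe_one, one_mul, a_mul_unip, smul_smul, ← Real.exp_add]
  simp [horoElt]

lemma kappa_horoElt (q : ℝ × (Fin d → ℝ)) : kappa (horoElt q) = 1 := by
  rw [horoElt_eq, kappa_iwasawa _ _ (unip_mem_N _)]

lemma H_horoElt (q : ℝ × (Fin d → ℝ)) : H (horoElt q) = q.1 := by
  rw [horoElt_eq, H_iwasawa _ _ (unip_mem_N _)]

lemma kappa_mul_of_kappa_eq_one (g : G d) {p : G d} (hp : kappa p = 1) :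
    kappa (g * p) = kappa g := by
  rw [kappa_mul, hp, Subgroup.coe_one, mul_one]

lemma H_mul_of_kappa_eq_one (g : G d) {p : G d} (hp : kappa p = 1) :
    H (g * p) = H g + H p := by
  rw [H_mul, hp, Subgroup.coe_one, mul_one]

/-- Choose `p = n_x a_t` that takes the base point `o` to `g⁻¹ o`. Then `gp` fixes `o`, so it lies
in `K` and equals `κ(gp) = κ(g)`. Unlike the definition by choice, this expression is visibly
continuous in `g`. -/
lemma coe_kappa (g : G d) :
    (kappa g : G d) = g * horoElt (horoCoord (mat g⁻¹ *ᵥ basePt d)) := by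
  set q := horoCoord (mat g⁻¹ *ᵥ basePt d) with hq
  have hk : g * horoElt q ∈ K d := by
    change _ = _
    rw [mat_mul_mulVec, hq, mat_horoElt_horoCoord
      (mat_mulVec_mem_hyperboloid _ (basePt_mem_hyperboloid d)), ← mat_mul_mulVec,
      mul_inv_cancel, mat_one, Matrix.one_mulVec]
  have := kappa_coe ⟨_, hk⟩
  rw [← kappa_mul_of_kappa_eq_one g (kappa_horoElt q)]
  exact congrArg Subtype.val this

lemma continuous_kappa : Continuous (kappa (d := d)) := by
  rw [IsEmbedding.subtypeVal.continuous_iff]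
  have : Subtype.val ∘ kappa (d := d) =
      fun g => g * horoElt (horoCoord (mat g⁻¹ *ᵥ basePt d)) := funext coe_kappa
  rw [this]
  exact continuous_id.mul
    (continuous_horoElt.comp (continuous_horoCoord_mulVec.comp continuous_inv))

/-- The closed subgroup `AN`. -/
noncomputable def AN (d : ℕ) : Subgroup (G d) where
  carrier := {g | kappa g = 1}
  one_mem' := kappa_one
  mul_mem' := by
    intro g h hg hh
    exact (kappa_mul_of_kappa_eq_one g hh).trans hg
  inv_mem' := by
    intro g hg
    have := kappa_mul_of_kappa_eq_one g⁻¹ hg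
    rw [inv_mul_cancel, kappa_one] at this
    exact this.symm

lemma mem_AN {g : G d} : g ∈ AN d ↔ kappa g = 1 := Iff.rfl

lemma eq_horoElt_of_mem_AN {p : G d} (hp : p ∈ AN d) :
    p = horoElt (horoCoord (mat p *ᵥ basePt d)) := by
  have h := coe_kappa p⁻¹
  rw [inv_inv, mem_AN.1 ((AN d).inv_mem hp), Subgroup.coe_one] at h
  rw [← mul_left_cancel_iff (a := p⁻¹), ← h, inv_mul_cancel]

/-- The coordinates `(t, x) ↦ n_x a_t` on `AN`. -/
noncomputable def horoHomeomorph (d : ℕ) : ℝ × (Fin d → ℝ) ≃ₜ AN d where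
  toFun q := ⟨horoElt q, kappa_horoElt q⟩
  invFun p := horoCoord (mat (p : G d) *ᵥ basePt d)
  left_inv q := horoCoord_mat_horoElt q
  right_inv p := Subtype.ext (eq_horoElt_of_mem_AN p.2).symm
  continuous_toFun := continuous_horoElt.subtype_mk _
  continuous_invFun := continuous_horoCoord_mulVec.comp continuous_subtype_val

lemma kappa_inv_mul_mem_AN (g : G d) : (kappa g : G d)⁻¹ * g ∈ AN d := by
  rw [mem_AN, ← Subgroup.coe_inv, kappa_K_mul, inv_mul_cancel]

/-- The `AN`-component of an element of `G`. -/
noncomputable def anPart (g : G d) : AN d := ⟨(kappa g : G d)⁻¹ * g, kappa_inv_mul_mem_AN g⟩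

lemma coe_anPart (g : G d) : (anPart g : G d) = (kappa g : G d)⁻¹ * g := rfl

lemma H_anPart (g : G d) : H (anPart g : G d) = H g := by
  rw [coe_anPart, ← Subgroup.coe_inv, H_K_mul]

lemma continuous_anPart : Continuous (anPart (d := d)) :=
  ((continuous_subtype_val.comp continuous_kappa).inv.mul continuous_id).subtype_mk _

/-- The homeomorphism `K × AN → G`, `(k, p) ↦ k p⁻¹`. -/
noncomputable def iwasawaHomeomorph (d : ℕ) : K d × AN d ≃ₜ G d where
  toFun x := x.1 * (x.2 : G d)⁻¹
  invFun g := (kappa g, (anPart g)⁻¹)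
  left_inv x := by
    have h : kappa ((x.1 : G d) * (x.2 : G d)⁻¹) = x.1 := by
      rw [kappa_mul_of_kappa_eq_one _ (mem_AN.1 ((AN d).inv_mem x.2.2)), kappa_coe]
    refine Prod.ext h (Subtype.ext ?_)
    simp [h, coe_anPart]
  right_inv g := by simp [coe_anPart]
  continuous_toFun := (continuous_subtype_val.comp continuous_fst).mul
    (continuous_subtype_val.comp continuous_snd).inv
  continuous_invFun := continuous_kappa.prodMk continuous_anPart.inv

instance (d : ℕ) : SecondCountableTopology (G d) := by
  have : SecondCountableTopology (Matrix (Idx d) (Idx d) ℝ) :=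
    inferInstanceAs (SecondCountableTopology (Idx d → Idx d → ℝ))
  exact isEmbedding_mat.secondCountableTopology

instance (d : ℕ) : SecondCountableTopology (K d) :=
  IsEmbedding.subtypeVal.secondCountableTopology

instance (d : ℕ) : SecondCountableTopology (AN d) :=
  IsEmbedding.subtypeVal.secondCountableTopology

instance (d : ℕ) : LocallyCompactSpace (AN d) :=
  (horoHomeomorph d).symm.isClosedEmbedding.locallyCompactSpace

instance (d : ℕ) : LocallyCompactSpace (G d) :=
  (iwasawaHomeomorph d).symm.isClosedEmbedding.locallyCompactSpace

end Horospherical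

/-! ### Haar measures on `AN` and on `G` -/

section HaarAN

variable {d : ℕ}

instance (d : ℕ) : MeasurableSpace (G d) := borel _

instance (d : ℕ) : BorelSpace (G d) := ⟨rfl⟩

/-- The measure `e^{-dt} dt dx` on `ℝ × ℝ^d`. -/
noncomputable def horoMeasure (d : ℕ) : Measure (ℝ × (Fin d → ℝ)) :=
  volume.withDensity fun q => ENNReal.ofReal (Real.exp (-(d * q.1)))

instance : IsFiniteMeasureOnCompacts (horoMeasure d) := by
  have : IsLocallyFiniteMeasure (horoMeasure d) :=
    IsLocallyFiniteMeasure.withDensity_ofReal (by fun_prop)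
  infer_instance

instance : (horoMeasure d).IsOpenPosMeasure := by
  refine Measure.AbsolutelyContinuous.isOpenPosMeasure (μ := volume) ?_
  refine withDensity_absolutelyContinuous' (by fun_prop) (ae_of_all _ fun q => ?_)
  simpa using Real.exp_pos _

lemma lintegral_horoMeasure {F : ℝ × (Fin d → ℝ) → ℝ≥0∞} (hF : Measurable F) :
    ∫⁻ q, F q ∂horoMeasure d =
      ∫⁻ t : ℝ, ENNReal.ofReal (Real.exp (-(d * t))) * ∫⁻ x, F (t, x) := by
  have hw : Measurable fun q : ℝ × (Fin d → ℝ) => ENNReal.ofReal (Real.exp (-(d * q.1))) := by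
    fun_prop
  rw [horoMeasure, lintegral_withDensity_eq_lintegral_mul _ hw hF, Measure.volume_eq_prod,
    lintegral_prod _ (hw.mul hF).aemeasurable]
  refine lintegral_congr fun t => ?_
  simp only [Pi.mul_apply]
  rw [lintegral_const_mul _ (by fun_prop)]

lemma lintegral_comp_exp_smul {f : (Fin d → ℝ) → ℝ≥0∞} (hf : Measurable f) (u : ℝ)
    (y : Fin d → ℝ) :
    ∫⁻ x, f (y + Real.exp u • x) = ENNReal.ofReal (Real.exp (-(d * u))) * ∫⁻ x, f x := by
  have h1 : ∫⁻ x, f (y + Real.exp u • x) =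
      ∫⁻ x, f (y + x) ∂(Measure.map (Real.exp u • ·) volume) := by
    rw [lintegral_map (by fun_prop) (by fun_prop)]
  rw [h1, Measure.map_addHaar_smul _ (Real.exp_pos u).ne', lintegral_smul_measure,
    lintegral_add_left_eq_self]
  congr 2
  rw [Module.finrank_fin_fun, abs_of_pos (by positivity), ← Real.exp_nat_mul, ← Real.exp_neg]

lemma ofReal_exp_mul (x y : ℝ) : ENNReal.ofReal (Real.exp x) * ENNReal.ofReal (Real.exp y) =
    ENNReal.ofReal (Real.exp (x + y)) := by
  rw [← ENNReal.ofReal_mul (Real.exp_pos x).le, Real.exp_add]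

/-- The factor `e^{-d q₀.1}` from rescaling `x` cancels the change of the density under the shift of
`t`. -/
lemma lintegral_horoMeasure_left {F : ℝ × (Fin d → ℝ) → ℝ≥0∞} (hF : Measurable F)
    (q₀ : ℝ × (Fin d → ℝ)) :
    ∫⁻ q, F (q₀.1 + q.1, q₀.2 + Real.exp q₀.1 • q.2) ∂horoMeasure d =
      ∫⁻ q, F q ∂horoMeasure d := by
  rw [lintegral_horoMeasure (by fun_prop), lintegral_horoMeasure hF]
  conv_rhs => rw [← lintegral_add_left_eq_self _ q₀.1]
  refine lintegral_congr fun t => ?_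
  dsimp only
  rw [lintegral_comp_exp_smul (f := fun x => F (q₀.1 + t, x)) (by fun_prop), ← mul_assoc,
    ofReal_exp_mul]
  congr 3
  ring

/-- Here `x` is only translated, so the shift of the density in `t` is not compensated. The
remaining factor is the modulus of `AN` and the source of the Jacobian `e^{-d H(gk)}` on `K`. -/
lemma lintegral_horoMeasure_right {F : ℝ × (Fin d → ℝ) → ℝ≥0∞} (hF : Measurable F)
    (q₀ : ℝ × (Fin d → ℝ)) :
    ∫⁻ q, F (q.1 + q₀.1, q.2 + Real.exp q.1 • q₀.2) ∂horoMeasure d =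
      ENNReal.ofReal (Real.exp (d * q₀.1)) * ∫⁻ q, F q ∂horoMeasure d := by
  rw [lintegral_horoMeasure (by fun_prop), lintegral_horoMeasure hF,
    ← lintegral_add_right_eq_self (fun t : ℝ => ENNReal.ofReal (Real.exp (-(d * t))) *
      ∫⁻ x, F (t, x)) q₀.1, ← lintegral_const_mul']
  · refine lintegral_congr fun t => ?_
    dsimp only
    rw [lintegral_add_right_eq_self (fun x => F (t + q₀.1, x)), ← mul_assoc, ofReal_exp_mul]
    congr 3
    ring
  · exact ENNReal.ofReal_ne_top

/-- The left Haar measure `e^{-dt} dt dx` of `AN`. -/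
noncomputable def haarAN (d : ℕ) : Measure (AN d) := (horoMeasure d).map (horoHomeomorph d)

lemma lintegral_haarAN {φ : AN d → ℝ≥0∞} (hφ : Measurable φ) :
    ∫⁻ p, φ p ∂haarAN d = ∫⁻ q, φ (horoHomeomorph d q) ∂horoMeasure d :=
  lintegral_map hφ (horoHomeomorph d).measurable

lemma horoHomeomorph_mul (q₀ q : ℝ × (Fin d → ℝ)) :
    horoHomeomorph d q₀ * horoHomeomorph d q =
      horoHomeomorph d (q₀.1 + q.1, q₀.2 + Real.exp q₀.1 • q.2) := by
  refine Subtype.ext ?_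
  change horoElt q₀ * horoElt q = horoElt _
  conv_lhs => rw [horoElt, mul_assoc, a_mul_horoElt, unip_mul_horoElt]

instance : (haarAN d).IsMulLeftInvariant where
  map_mul_left_eq_self p := by
    obtain ⟨q₀, rfl⟩ := (horoHomeomorph d).surjective p
    refine Measure.ext_of_lintegral _ fun φ hφ => ?_
    rw [lintegral_map hφ (by fun_prop), lintegral_haarAN (by fun_prop), lintegral_haarAN hφ]
    simp only [horoHomeomorph_mul]
    exact lintegral_horoMeasure_left (F := fun q => φ (horoHomeomorph d q))
      (hφ.comp (horoHomeomorph d).measurable) q₀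

lemma lintegral_haarAN_mul_right {φ : AN d → ℝ≥0∞} (hφ : Measurable φ) (p₀ : AN d) :
    ∫⁻ p, φ (p * p₀) ∂haarAN d =
      ENNReal.ofReal (Real.exp (d * H (p₀ : G d))) * ∫⁻ p, φ p ∂haarAN d := by
  obtain ⟨q₀, rfl⟩ := (horoHomeomorph d).surjective p₀
  rw [lintegral_haarAN (by fun_prop), lintegral_haarAN hφ]
  simp only [horoHomeomorph_mul]
  rw [show H ((horoHomeomorph d q₀ : AN d) : G d) = q₀.1 from H_horoElt q₀]
  exact lintegral_horoMeasure_right (F := fun q => φ (horoHomeomorph d q))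
    (hφ.comp (horoHomeomorph d).measurable) q₀

instance : (haarAN d).IsHaarMeasure where
  lt_top_of_isCompact := (Measure.IsFiniteMeasureOnCompacts.map _ (horoHomeomorph d)).lt_top_of_isCompact
  open_pos :=
    ((horoHomeomorph d).continuous.isOpenPosMeasure_map (horoHomeomorph d).surjective).open_pos

end HaarAN

/-! ### Unimodularity and the Jacobian of `k ↦ κ(gk)`. -/

section HaarG

variable {d : ℕ}

/-- Some element of `G` reverses the direction of `A`. -/
lemma exists_conj_a_eq_a_neg (hd : 1 ≤ d) : ∃ w : G d, ∀ t, w * a d t * w⁻¹ = a d (-t) := by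
  -- The diagonal matrix `w` reverses the space direction in which `A` translates. A second sign, on
  -- the coordinate `i₀`, restores determinant one; it is available because `d ≥ 1`.
  set i₀ : Fin d := ⟨0, hd⟩
  set v : Idx d → ℝ := Sum.elim (fun i => if i = i₀ then -1 else 1) ![-1, 1] with hv
  have hdet : (Matrix.diagonal v).det = 1 := by
    rw [Matrix.det_diagonal, Fintype.prod_sum_type]
    simp [hv, Fin.prod_univ_two, Finset.prod_ite_eq']
  have hG : (⟨Matrix.diagonal v, hdet⟩ : Matrix.SpecialLinearGroup (Idx d) ℝ) ∈ G d := by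
    have hsq : ∀ i, v i * v i = 1 := by
      rintro (i | i)
      · simp only [hv, Sum.elim_inl]; split_ifs <;> norm_num
      · fin_cases i <;> simp [hv]
    have hl : lorentz d = Matrix.diagonal (Sum.elim (fun _ => 1) ![1, -1]) := by
      ext i j
      rcases i with i | i <;> rcases j with j | j
      · simp [lorentz, Matrix.one_apply, Matrix.diagonal_apply]
      · simp [lorentz]
      · simp [lorentz]
      · fin_cases i <;> fin_cases j <;> simp [lorentz]
    have hq : (Matrix.diagonal v)ᵀ * lorentz d * Matrix.diagonal v = lorentz d := by
      rw [hl, Matrix.diagonal_transpose, Matrix.diagonal_mul_diagonal,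
        Matrix.diagonal_mul_diagonal]
      congr 1
      ext i
      linear_combination (Sum.elim (fun _ => 1) ![1, -1] i : ℝ) * hsq i
    refine ⟨hq, fun x hx => ⟨(lorentz_mulVec hq x x).trans hx.1, ?_⟩⟩
    rw [Matrix.mulVec_diagonal]
    simpa [hv] using hx.2
  refine ⟨⟨_, hG⟩, fun t => ?_⟩
  rw [mul_inv_eq_iff_eq_mul]
  apply mat_injective
  rw [mat_mul, mat_mul]
  simp only [mat]
  ext i j
  rw [Matrix.diagonal_mul, Matrix.mul_diagonal]
  rcases i with i | i <;> rcases j with j | j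
  · simp [a, boostMat, Matrix.one_apply]
    split_ifs with h
    · rw [h]
    · rfl
  · simp [a, boostMat]
  · simp [a, boostMat]
  · fin_cases i <;> fin_cases j <;> simp [a, boostMat, hv]

lemma nnreal_eq_one_of_mul_self {x : NNReal} (h : x * x = 1) : x = 1 := by
  have h1 : (x : ℝ) * x = 1 := by exact_mod_cast h
  have h2 : (x : ℝ) = 1 := by nlinarith [x.coe_nonneg]
  exact_mod_cast h2

lemma modularCharacter_conj {Γ : Type*} [TopologicalSpace Γ] [Group Γ] [IsTopologicalGroup Γ]
    [LocallyCompactSpace Γ] (g h : Γ) :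
    Measure.modularCharacter (g * h * g⁻¹) = Measure.modularCharacter h := by
  rw [map_mul, mul_comm, ← map_mul, inv_mul_cancel_left]

/-- The modular character is invariant under conjugation and `a_t` is conjugate to its inverse, so
its value there is a non-negative number with square one. -/
lemma modularCharacter_a (hd : 1 ≤ d) (t : ℝ) : Measure.modularCharacter (a d t) = 1 := by
  obtain ⟨w, hw⟩ := exists_conj_a_eq_a_neg hd
  have h1 := modularCharacter_conj w (a d t)
  rw [hw] at h1
  refine nnreal_eq_one_of_mul_self ?_
  nth_rw 1 [← h1]
  rw [← map_mul, a_mul, neg_add_cancel, a_zero, map_one]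

/-- Conjugation by `a_{log 2}` doubles `x`, that is, squares `n_x`. The value at `n_x` is thus equal
to its own square, and it is not zero. -/
lemma modularCharacter_unip (x : Fin d → ℝ) : Measure.modularCharacter (unip x) = 1 := by
  have h1 : a d (Real.log 2) * unip x * (a d (Real.log 2))⁻¹ = unip x * unip x := by
    rw [a_mul_unip, Real.exp_log two_pos, mul_inv_cancel_right, unip_add, two_smul]
  have h2 := modularCharacter_conj (a d (Real.log 2)) (unip x)
  rw [h1, map_mul] at h2
  have h3 : Measure.modularCharacter (unip x) ≠ 0 := (Measure.modularCharacterFun_pos _).ne'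
  exact mul_left_cancel₀ h3 (by rw [h2, mul_one])

lemma modularCharacter_AN (hd : 1 ≤ d) (p : AN d) : Measure.modularCharacter (p : G d) = 1 := by
  rw [eq_horoElt_of_mem_AN p.2, horoElt, map_mul, modularCharacter_unip, modularCharacter_a hd,
    mul_one]

lemma map_mul_right_AN_haar (hd : 1 ≤ d) (p : AN d) :
    Measure.map (· * (p : G d)) (Measure.haar : Measure (G d)) = Measure.haar := by
  have h := Measure.map_right_mul_eq_modularCharacterFun_smul (Measure.haar : Measure (G d)) (p : G d)
  rw [h, show Measure.modularCharacterFun (p : G d) = 1 from modularCharacter_AN hd p, one_smul]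

/-- Haar measure of `G` in the coordinates `(k, p) ↦ k p⁻¹`. -/
lemma exists_map_haar_eq_smul (hd : 1 ≤ d) : ∃ c : NNReal, c ≠ 0 ∧
    (Measure.haar : Measure (G d)).map (iwasawaHomeomorph d).symm =
      c • (haarProb (K d)).prod (haarAN d) := by
  set ν := (Measure.haar : Measure (G d)).map (iwasawaHomeomorph d).symm with hν
  have hinv : ν.IsMulLeftInvariant := by
    refine ⟨fun x => ?_⟩
    -- The inverse in `k p⁻¹` serves this step: left translation of `K × AN` by `(k₀, p₀)` becomes
    -- `g ↦ k₀ g p₀⁻¹`, which preserves Haar measure of `G` by left invariance and triviality of the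
    -- modular character on `AN`.
    have h1 : (x * ·) ∘ (iwasawaHomeomorph d).symm = (iwasawaHomeomorph d).symm ∘
        ((· * ((x.2⁻¹ : AN d) : G d)) ∘ ((x.1 : G d) * ·)) := by
      funext g
      simp only [Function.comp_apply]
      rw [eq_comm, Homeomorph.symm_apply_eq]
      obtain ⟨y, rfl⟩ := (iwasawaHomeomorph d).surjective g
      rw [Homeomorph.symm_apply_apply]
      simp [iwasawaHomeomorph, mul_assoc]
    rw [hν, Measure.map_map (by fun_prop) (Homeomorph.measurable _), h1,
      ← Measure.map_map (Homeomorph.measurable _) (by fun_prop),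
      ← Measure.map_map (by fun_prop) (by fun_prop), map_mul_left_eq_self,
      map_mul_right_AN_haar hd]
  have hhaar : ν.IsHaarMeasure :=
    { lt_top_of_isCompact :=
        (Measure.IsFiniteMeasureOnCompacts.map _ (iwasawaHomeomorph d).symm).lt_top_of_isCompact
      open_pos := ((iwasawaHomeomorph d).symm.continuous.isOpenPosMeasure_map
        (iwasawaHomeomorph d).symm.surjective).open_pos }
  refine ⟨_, ?_, Measure.isMulLeftInvariant_eq_smul ν ((haarProb (K d)).prod (haarAN d))⟩
  exact (Measure.haarScalarFactor_pos_of_isHaarMeasure _ _).ne'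

/-- The change of variables `k ↦ κ(gk)` on `K`. -/
theorem lintegral_kappa_mul (hd : 1 ≤ d) (g : G d) {F : K d → ℝ≥0∞} (hF : Measurable F) :
    ∫⁻ k : K d, F (kappa (g * (k : G d))) * ENNReal.ofReal (Real.exp (-(d * H (g * (k : G d))))) ∂haarProb (K d) =
      ∫⁻ k, F k ∂haarProb (K d) := by
  obtain ⟨c, hc, hν⟩ := exists_map_haar_eq_smul hd
  obtain ⟨C, hC, hC1⟩ := exists_compact_mem_nhds (1 : AN d)
  -- An auxiliary function on `AN` with finite non-zero integral. It turns `F` into a function on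
  -- `G`, and its integral is cancelled at the end.
  set φ : AN d → ℝ≥0∞ := C.indicator 1 with hφ
  have hφm : Measurable φ := measurable_one.indicator hC.measurableSet
  have hφI : ∫⁻ p, φ p ∂haarAN d = haarAN d C := by
    rw [hφ, lintegral_indicator_one hC.measurableSet]
  have hI0 : haarAN d C ≠ 0 := (Measure.measure_pos_of_mem_nhds _ hC1).ne'
  have hItop : haarAN d C ≠ ∞ := hC.measure_lt_top.ne
  have hmk : Measurable fun k : K d => kappa (g * (k : G d)) :=
    (continuous_kappa.comp (continuous_const.mul continuous_subtype_val)).measurable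
  have hmH : Measurable fun k : K d => H (g * (k : G d)) :=
    (continuous_H.comp (continuous_const.mul continuous_subtype_val)).measurable
  set Φ : K d × AN d → ℝ≥0∞ := fun x => F x.1 * φ x.2 with hΦ
  have hΦm : Measurable Φ := by fun_prop
  have hG : ∀ Ψ : K d × AN d → ℝ≥0∞, Measurable Ψ →
      ∫⁻ y, Ψ ((iwasawaHomeomorph d).symm y) ∂(Measure.haar : Measure (G d)) =
        c * ∫⁻ k, ∫⁻ p, Ψ (k, p) ∂haarAN d ∂haarProb (K d) := by
    intro Ψ hΨ
    rw [← lintegral_map hΨ (Homeomorph.measurable _), hν,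
      show c • (haarProb (K d)).prod (haarAN d) = (c : ℝ≥0∞) • (haarProb (K d)).prod (haarAN d) from rfl,
      lintegral_smul_measure, lintegral_prod _ hΨ.aemeasurable, smul_eq_mul]
  -- Since `gk = κ(gk) q` with `q ∈ AN`, one has `g k p⁻¹ = κ(gk) (p q⁻¹)⁻¹`. Left translation by
  -- `g` therefore acts on the `AN`-coordinate by a right translation, whose modulus is `e^{d
  -- H(q⁻¹)} = e^{-d H(gk)}`.
  have hT : ∀ y : K d × AN d, (iwasawaHomeomorph d).symm (g * iwasawaHomeomorph d y) =
      (kappa (g * (y.1 : G d)), y.2 * (anPart (g * (y.1 : G d)))⁻¹) := by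
    intro y
    rw [Homeomorph.symm_apply_eq]
    simp [iwasawaHomeomorph, mul_assoc, coe_anPart]
  have hTm : Measurable fun y : K d × AN d =>
      (iwasawaHomeomorph d).symm (g * iwasawaHomeomorph d y) :=
    ((iwasawaHomeomorph d).symm.continuous.comp
      (continuous_const.mul (iwasawaHomeomorph d).continuous)).measurable
  have h1 := hG Φ hΦm
  have h2 := hG (fun y => Φ ((iwasawaHomeomorph d).symm (g * iwasawaHomeomorph d y)))
    (hΦm.comp hTm)
  simp only [Homeomorph.apply_symm_apply] at h2
  -- Left invariance of Haar measure of `G` equates the integral of `Φ` with that of its translate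
  -- by `g`.
  rw [lintegral_mul_left_eq_self (fun y => Φ ((iwasawaHomeomorph d).symm y)) g, h1] at h2
  have h3 : ∀ k : K d, ∫⁻ p, Φ ((iwasawaHomeomorph d).symm (g * iwasawaHomeomorph d (k, p)))
      ∂haarAN d = F (kappa (g * (k : G d))) * ENNReal.ofReal (Real.exp (-(d * H (g * (k : G d))))) *
        haarAN d C := by
    intro k
    simp only [hT, hΦ]
    rw [lintegral_const_mul _ (by fun_prop), lintegral_haarAN_mul_right hφm, hφI, mul_assoc]
    congr 4
    have h4 := H_mul_of_kappa_eq_one (anPart (g * (k : G d)) : G d)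
      (mem_AN.1 ((anPart (g * (k : G d)))⁻¹).2)
    rw [Subgroup.coe_inv, mul_inv_cancel, H_one, H_anPart] at h4
    rw [Subgroup.coe_inv]
    linear_combination (-(d : ℝ)) * h4
  have h5 : ∀ k : K d, ∫⁻ p, Φ (k, p) ∂haarAN d = F k * haarAN d C := by
    intro k
    simp only [hΦ]
    rw [lintegral_const_mul _ hφm, hφI]
  simp only [h3, h5] at h2
  have hc0 : (c : ℝ≥0∞) ≠ 0 := by exact_mod_cast hc
  have h6 := (ENNReal.mul_right_inj hc0 ENNReal.coe_ne_top).1 h2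
  rw [lintegral_mul_const _ hF, lintegral_mul_const _ (by fun_prop)] at h6
  exact ((ENNReal.mul_left_inj hI0 hItop).1 h6).symm

/-- The pull-back of Haar measure of `K` under `k ↦ κ(gk)` has density `e^{-d H(gk)}`. -/
theorem map_kappa_withDensity (hd : 1 ≤ d) (g : G d) :
    ((haarProb (K d)).withDensity
      fun k : K d => ENNReal.ofReal (Real.exp (-(d * H (g * (k : G d)))))).map
        (fun k : K d => kappa (g * (k : G d))) = haarProb (K d) := by
  have hmk : Measurable fun k : K d => kappa (g * (k : G d)) :=
    (continuous_kappa.comp (continuous_const.mul continuous_subtype_val)).measurable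
  have hmH : Measurable fun k : K d => H (g * (k : G d)) :=
    (continuous_H.comp (continuous_const.mul continuous_subtype_val)).measurable
  refine Measure.ext_of_lintegral _ fun F hF => ?_
  rw [lintegral_map hF hmk, lintegral_withDensity_eq_lintegral_mul _ (by fun_prop)
    (show Measurable fun k : K d => F (kappa (g * (k : G d))) from hF.comp hmk),
    ← lintegral_kappa_mul hd g hF]
  exact lintegral_congr fun k => mul_comm _ _

theorem integral_kappa_mul (hd : 1 ≤ d) (g : G d) {E : Type*} [NormedAddCommGroup E]
    [NormedSpace ℝ E] {F : K d → E} (hF : AEStronglyMeasurable F (haarProb (K d))) :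
    ∫ k : K d, Real.exp (-(d * H (g * (k : G d)))) • F (kappa (g * (k : G d))) ∂haarProb (K d) =
      ∫ k, F k ∂haarProb (K d) := by
  have hmk : Measurable fun k : K d => kappa (g * (k : G d)) :=
    (continuous_kappa.comp (continuous_const.mul continuous_subtype_val)).measurable
  have hmH : Measurable fun k : K d => H (g * (k : G d)) :=
    (continuous_H.comp (continuous_const.mul continuous_subtype_val)).measurable
  conv_rhs => rw [← map_kappa_withDensity hd g]
  rw [integral_map hmk.aemeasurable (by rwa [map_kappa_withDensity hd g]),
    integral_withDensity_eq_integral_toReal_smul (by fun_prop)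
      (ae_of_all _ fun _ => ENNReal.ofReal_lt_top)]
  refine integral_congr_ae (ae_of_all _ fun k => ?_)
  simp only [ENNReal.toReal_ofReal (Real.exp_pos _).le]

/-- Preimages of null sets under `k ↦ κ(gk)` are null because the density `e^{-d H(gk)}` is
positive. Hence `Us` may be computed on any representative of an `L²` class, in particular on a
continuous one (`Us_toLp`). -/
theorem quasiMeasurePreserving_kappa_mul (hd : 1 ≤ d) (g : G d) :
    Measure.QuasiMeasurePreserving (fun k : K d => kappa (g * (k : G d))) (haarProb (K d))
      (haarProb (K d)) := by
  have hmk : Measurable fun k : K d => kappa (g * (k : G d)) :=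
    (continuous_kappa.comp (continuous_const.mul continuous_subtype_val)).measurable
  have hmH : Measurable fun k : K d => H (g * (k : G d)) :=
    (continuous_H.comp (continuous_const.mul continuous_subtype_val)).measurable
  refine ⟨hmk, ?_⟩
  conv_rhs => rw [← map_kappa_withDensity hd g]
  refine Measure.AbsolutelyContinuous.map ?_ hmk
  refine withDensity_absolutelyContinuous' (Measurable.aemeasurable (by fun_prop)) (ae_of_all _ fun q => ?_)
  simpa using Real.exp_pos _

end HaarG

/-! ### Isotypic projections and point evaluations -/

section Schur

open scoped Matrix.Norms.Elementwise

variable {Γ : Type} [Group Γ] [TopologicalSpace Γ] [IsTopologicalGroup Γ] [CompactSpace Γ]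
  [MeasurableSpace Γ] [BorelSpace Γ]

/-- The matrix of `τ(k)`. -/
abbrev UnitaryIrrep.mat (τ : UnitaryIrrep Γ) (k : Γ) : Matrix (Fin τ.dim) (Fin τ.dim) ℂ :=
  (τ.hom k : Matrix (Fin τ.dim) (Fin τ.dim) ℂ)

lemma UnitaryIrrep.mat_mul (τ : UnitaryIrrep Γ) (k l : Γ) :
    τ.mat (k * l) = τ.mat k * τ.mat l := by
  simp [UnitaryIrrep.mat]

lemma UnitaryIrrep.mat_mul_conjTranspose (τ : UnitaryIrrep Γ) (k : Γ) :
    τ.mat k * (τ.mat k)ᴴ = 1 :=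
  Matrix.mem_unitaryGroup_iff.1 (τ.hom k).2

lemma UnitaryIrrep.conjTranspose_mul_mat (τ : UnitaryIrrep Γ) (k : Γ) :
    (τ.mat k)ᴴ * τ.mat k = 1 :=
  Matrix.mem_unitaryGroup_iff'.1 (τ.hom k).2

lemma UnitaryIrrep.mat_inv (τ : UnitaryIrrep Γ) (k : Γ) : τ.mat k⁻¹ = (τ.mat k)ᴴ := by
  have h : τ.mat k⁻¹ * τ.mat k = 1 := by
    rw [← τ.mat_mul, inv_mul_cancel]
    simp [UnitaryIrrep.mat]
  calc τ.mat k⁻¹ = τ.mat k⁻¹ * (τ.mat k * (τ.mat k)ᴴ) := by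
        rw [τ.mat_mul_conjTranspose, mul_one]
    _ = _ := by rw [← mul_assoc, h, one_mul]

/-- **Schur's lemma**. -/
lemma UnitaryIrrep.exists_eq_smul_one (τ : UnitaryIrrep Γ)
    (A : Matrix (Fin τ.dim) (Fin τ.dim) ℂ) (hA : ∀ k, A * τ.mat k = τ.mat k * A) :
    ∃ c : ℂ, A = c • (1 : Matrix (Fin τ.dim) (Fin τ.dim) ℂ) := by
  have : Nonempty (Fin τ.dim) := ⟨⟨0, τ.dim_pos⟩⟩
  obtain ⟨c, hc⟩ := Module.End.exists_eigenvalue (Matrix.toLin' A)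
  refine ⟨c, ?_⟩
  have hW : ∀ k, ∀ w ∈ Module.End.eigenspace (Matrix.toLin' A) c,
      τ.mat k *ᵥ w ∈ Module.End.eigenspace (Matrix.toLin' A) c := by
    intro k w hw
    rw [Module.End.mem_eigenspace_iff, Matrix.toLin'_apply] at hw ⊢
    rw [Matrix.mulVec_mulVec, hA k, ← Matrix.mulVec_mulVec, hw, Matrix.mulVec_smul]
  rcases τ.irreducible _ hW with h | h
  · exact absurd h hc
  · apply Matrix.mulVec_injective
    ext1 w
    have hw : w ∈ Module.End.eigenspace (Matrix.toLin' A) c := h ▸ Submodule.mem_top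
    rw [Module.End.mem_eigenspace_iff, Matrix.toLin'_apply] at hw
    rw [hw, Matrix.smul_mulVec, Matrix.one_mulVec]

/-- **Schur orthogonality** in matrix form. -/
lemma UnitaryIrrep.integral_mat_mul_mul (τ : UnitaryIrrep Γ)
    (X : Matrix (Fin τ.dim) (Fin τ.dim) ℂ) :
    ∫ k, τ.mat k * X * (τ.mat k)ᴴ ∂haarProb Γ =
      (X.trace / τ.dim) • (1 : Matrix (Fin τ.dim) (Fin τ.dim) ℂ) := by
  have hcont : Continuous fun k => τ.mat k * X * (τ.mat k)ᴴ :=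
    (τ.continuous_hom.mul continuous_const).mul τ.continuous_hom.matrix_conjTranspose
  have hint := integrable_of_continuous hcont
  set A := ∫ k, τ.mat k * X * (τ.mat k)ᴴ ∂haarProb Γ with hA
  obtain ⟨c, hc⟩ := τ.exists_eq_smul_one A fun h => by
    -- Invariance of Haar measure under `k ↦ hk` makes the average `A` commute with `τ`, so that
    -- Schur's lemma applies. The scalar is then read off from the trace.
    have h1 : τ.mat h * A * (τ.mat h)ᴴ = A := by
      let L : Matrix (Fin τ.dim) (Fin τ.dim) ℂ →ₗ[ℂ] Matrix (Fin τ.dim) (Fin τ.dim) ℂ :=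
        (LinearMap.mulRight ℂ (τ.mat h)ᴴ).comp (LinearMap.mulLeft ℂ (τ.mat h))
      have h2 : ∫ k, τ.mat h * (τ.mat k * X * (τ.mat k)ᴴ) * (τ.mat h)ᴴ ∂haarProb Γ =
          τ.mat h * A * (τ.mat h)ᴴ :=
        (LinearMap.toContinuousLinearMap L).integral_comp_comm hint
      refine h2.symm.trans (Eq.trans ?_ (integral_mul_left_eq_self
        (fun k => τ.mat k * X * (τ.mat k)ᴴ) h))
      refine integral_congr_ae (ae_of_all _ fun k => ?_)
      simp only [τ.mat_mul, Matrix.conjTranspose_mul, mul_assoc]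
    calc A * τ.mat h = τ.mat h * A * (τ.mat h)ᴴ * τ.mat h := by rw [h1]
      _ = τ.mat h * A := by rw [mul_assoc, τ.conjTranspose_mul_mat, mul_one]
  have htr : A.trace = X.trace := by
    have h2 : ∫ k, (τ.mat k * X * (τ.mat k)ᴴ).trace ∂haarProb Γ = A.trace :=
      (LinearMap.toContinuousLinearMap
        (Matrix.traceLinearMap (Fin τ.dim) ℂ ℂ)).integral_comp_comm hint
    rw [← h2]
    have h4 : ∀ k, (τ.mat k * X * (τ.mat k)ᴴ).trace = X.trace := by
      intro k
      rw [Matrix.trace_mul_comm, ← mul_assoc, τ.conjTranspose_mul_mat, one_mul]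
    simp [h4]
  have hd : (τ.dim : ℂ) ≠ 0 := by exact_mod_cast τ.dim_pos.ne'
  rw [hc, Matrix.trace_smul, Matrix.trace_one, Fintype.card_fin, smul_eq_mul] at htr
  rw [hc, ← htr, mul_div_cancel_right₀ _ hd]

lemma UnitaryIrrep.integral_entry_mul_conj (τ : UnitaryIrrep Γ) (i a j b : Fin τ.dim) :
    ∫ k, τ.mat k i a * conj (τ.mat k j b) ∂haarProb Γ =
      if i = j ∧ a = b then (τ.dim : ℂ)⁻¹ else 0 := by
  have h := τ.integral_mat_mul_mul (Matrix.single a b 1)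
  have hcont : Continuous fun k => τ.mat k * Matrix.single a b 1 * (τ.mat k)ᴴ :=
    (τ.continuous_hom.mul continuous_const).mul τ.continuous_hom.matrix_conjTranspose
  have h2 : ∫ k, (τ.mat k * Matrix.single a b 1 * (τ.mat k)ᴴ : Matrix (Fin τ.dim) (Fin τ.dim) ℂ) i j
      ∂haarProb Γ = (∫ k, τ.mat k * Matrix.single a b 1 * (τ.mat k)ᴴ ∂haarProb Γ :
        Matrix (Fin τ.dim) (Fin τ.dim) ℂ) i j :=
    (LinearMap.toContinuousLinearMap
      (Matrix.entryLinearMap ℂ ℂ i j)).integral_comp_comm (integrable_of_continuous hcont)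
  rw [h] at h2
  have h4 : ∀ k, (τ.mat k * Matrix.single a b 1 * (τ.mat k)ᴴ :
      Matrix (Fin τ.dim) (Fin τ.dim) ℂ) i j =
      τ.mat k i a * conj (τ.mat k j b) := by
    intro k
    simp [Matrix.mul_apply, Matrix.single_apply, ite_and, Finset.sum_ite_eq, mul_ite]
  simp only [h4] at h2
  rw [h2, Matrix.smul_apply, Matrix.one_apply]
  by_cases hij : i = j <;> by_cases hab : a = b
  · simp [hij, hab]
  · simp [hij, hab, Matrix.trace_single_eq_of_ne]
  · simp [hij, hab]
  · simp [hij, hab]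

end Schur

/-! ### The projections `isoProj` and the reproducing vectors `evalVec`. -/

section Isotypic

variable {Γ : Type} [Group Γ] [TopologicalSpace Γ] [IsTopologicalGroup Γ] [CompactSpace Γ]
  [MeasurableSpace Γ] [BorelSpace Γ]

lemma UnitaryIrrep.integral_char_mul_conj (τ : UnitaryIrrep Γ) (i j : Fin τ.dim) :
    ∫ k, τ.char k * conj (τ.mat k i j) ∂haarProb Γ = if i = j then 1 else 0 := by
  have h1 : ∀ k, τ.char k * conj (τ.mat k i j) =
      ∑ a, (τ.dim : ℂ) * (τ.mat k a a * conj (τ.mat k i j)) := by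
    intro k
    rw [UnitaryIrrep.char, Matrix.trace, Finset.mul_sum, Finset.sum_mul]
    exact Finset.sum_congr rfl fun a _ => by rw [Matrix.diag_apply]; ring
  have hd : (τ.dim : ℂ) ≠ 0 := by exact_mod_cast τ.dim_pos.ne'
  simp only [h1]
  rw [integral_finsetSum]
  · simp only [integral_const_mul, τ.integral_entry_mul_conj]
    by_cases h : i = j
    · subst h; simp [hd]
    · simp only [h, if_false]
      refine Finset.sum_eq_zero fun a _ => ?_
      rw [if_neg fun h' => h (h'.1.symm.trans h'.2), mul_zero]
  · intro a _
    exact integrable_of_continuous (continuous_const.mul ((τ.continuous_entry a a).mul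
      (Complex.continuous_conj.comp (τ.continuous_entry i j))))

/-- Expanding `τ(k⁻¹x) = τ(k)ᴴ τ(x)` reduces the integral over `k` to the pairing of the character
with a matrix coefficient, which by orthogonality leaves only the original entry. -/
lemma isoProj_conjEntry (τ : UnitaryIrrep Γ) (p : Fin τ.dim × Fin τ.dim) :
    isoProj τ (ContinuousMap.toLp 2 (haarProb Γ) ℂ (conjEntry τ p)) =
      ContinuousMap.toLp 2 (haarProb Γ) ℂ (conjEntry τ p) := by
  have hint : Integrable (fun k : Γ => conj (τ.char k) •
      (conjEntry τ p).comp ⟨fun x => k⁻¹ * x, by fun_prop⟩) (haarProb Γ) :=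
    integrable_of_continuous
      ((Complex.continuous_conj.comp τ.continuous_char).smul (continuous_translate _))
  have h1 := (ContinuousMap.toLp (E := ℂ) 2 (haarProb Γ) ℂ).integral_comp_comm hint
  simp only [isoProj, leftReg_toLp]
  simp only [map_smul] at h1
  rw [h1]
  congr 1
  ext x
  have h2 := (ContinuousMap.evalCLM ℂ x).integral_comp_comm hint
  simp only [ContinuousMap.evalCLM_apply] at h2
  rw [← h2]
  simp only [ContinuousMap.coe_smul, Pi.smul_apply, ContinuousMap.comp_apply,
    ContinuousMap.coe_mk, smul_eq_mul, conjEntry]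
  have h3 : ∀ k : Γ, conj (τ.char k) * conj (τ.mat (k⁻¹ * x) p.1 p.2) =
      ∑ l, conj (τ.char k * conj (τ.mat k l p.1)) * conj (τ.mat x l p.2) := by
    intro k
    rw [τ.mat_mul, τ.mat_inv, Matrix.mul_apply, map_sum, Finset.mul_sum]
    refine Finset.sum_congr rfl fun l _ => ?_
    simp [Matrix.conjTranspose_apply]
    ring
  refine (integral_congr_ae (ae_of_all _ h3)).trans ?_
  rw [integral_finsetSum]
  · simp only [integral_mul_const, integral_conj, τ.integral_char_mul_conj]
    simp
  · intro l _
    refine integrable_of_continuous (Continuous.mul (Complex.continuous_conj.comp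
      (τ.continuous_char.mul (Complex.continuous_conj.comp (τ.continuous_entry l p.1))))
      continuous_const)

/-- The range consists of combinations of conjugate matrix coefficients of `τ`, and these are fixed.
-/
lemma isoProj_isoProj (τ : UnitaryIrrep Γ) (v : L2 Γ) : isoProj τ (isoProj τ v) = isoProj τ v := by
  obtain ⟨f, hf, hfv⟩ := isoProj_mem τ v
  rw [← hfv]
  simp only [ContinuousLinearMap.coe_coe]
  clear hfv
  induction hf using Submodule.span_induction with
  | mem f hf => obtain ⟨p, rfl⟩ := hf; exact isoProj_conjEntry τ p
  | zero => rw [map_zero]; simpa using isoProj_smul τ 0 0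
  | add f g _ _ hf hg => rw [map_add, isoProj_add, hf, hg]
  | smul c f _ hf => rw [map_smul, isoProj_smul, hf]

lemma leftReg_mul (k l : Γ) (v : L2 Γ) : leftReg (k * l) v = leftReg k (leftReg l v) := by
  have h := Lp.compMeasurePreserving_comp_apply (E := ℂ) (p := 2) v
    (measurePreserving_mul_left (haarProb Γ) l⁻¹) (measurePreserving_mul_left (haarProb Γ) k⁻¹)
  rw [leftReg, leftReg, leftReg, ← h]
  congr 2
  funext x
  simp [mul_assoc]

lemma leftReg_one (v : L2 Γ) : leftReg 1 v = v := by
  have h := leftReg_mul (1 : Γ) 1 v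
  rw [one_mul] at h
  refine ((Lp.isometry_compMeasurePreserving (E := ℂ) (p := 2)
    (measurePreserving_mul_left (haarProb Γ) (1 : Γ)⁻¹)).injective ?_)
  exact h.symm

lemma inner_leftReg_leftReg (k : Γ) (v w : L2 Γ) :
    inner ℂ (leftReg k v) (leftReg k w) = inner ℂ v w :=
  (Lp.compMeasurePreservingₗᵢ (E := ℂ) (p := 2) ℂ (fun x => k⁻¹ * x)
    (measurePreserving_mul_left (haarProb Γ) k⁻¹)).inner_map_map v w

lemma inner_leftReg_right (k : Γ) (v w : L2 Γ) :
    inner ℂ v (leftReg k w) = inner ℂ (leftReg k⁻¹ v) w := by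
  rw [← inner_leftReg_leftReg k (leftReg k⁻¹ v), ← leftReg_mul, mul_inv_cancel, leftReg_one]

/-- `λ(k)` as a continuous linear map. -/
noncomputable def leftRegL (k : Γ) : L2 Γ →L[ℂ] L2 Γ :=
  (Lp.compMeasurePreservingₗᵢ (E := ℂ) (p := 2) ℂ (fun x => k⁻¹ * x)
    (measurePreserving_mul_left (haarProb Γ) k⁻¹)).toContinuousLinearMap

lemma leftRegL_apply (k : Γ) (v : L2 Γ) : leftRegL k v = leftReg k v := rfl

lemma UnitaryIrrep.char_inv (τ : UnitaryIrrep Γ) (k : Γ) : τ.char k⁻¹ = conj (τ.char k) := by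
  have := τ.mat_inv k
  simp only [UnitaryIrrep.mat] at this
  rw [UnitaryIrrep.char, UnitaryIrrep.char, this, Matrix.trace_conjTranspose, map_mul, map_natCast]
  rfl

lemma UnitaryIrrep.char_conj (τ : UnitaryIrrep Γ) (h k : Γ) :
    τ.char (h * k * h⁻¹) = τ.char k := by
  have h1 : τ.mat (h * k * h⁻¹) = τ.mat h * τ.mat k * (τ.mat h)ᴴ := by
    rw [τ.mat_mul, τ.mat_mul, τ.mat_inv]
  have h2 : (τ.mat (h * k * h⁻¹)).trace = (τ.mat k).trace := by
    rw [h1, Matrix.trace_mul_comm, ← mul_assoc, τ.conjTranspose_mul_mat, one_mul]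
  rw [UnitaryIrrep.char, UnitaryIrrep.char]
  exact congrArg _ h2

lemma inner_isoProj_right (τ : UnitaryIrrep Γ) (v w : L2 Γ) :
    inner ℂ v (isoProj τ w) = ∫ k, conj (τ.char k) * inner ℂ v (leftReg k w) ∂haarProb Γ := by
  have := (innerSL ℂ v).integral_comp_comm (integrable_isoProj τ w)
  simp only [innerSL_apply_apply, inner_smul_right] at this
  exact this.symm

/-- Self-adjointness follows from the substitution `k ↦ k⁻¹`, under which the character is
conjugated and `λ(k)` becomes its adjoint. -/
lemma inner_isoProj (τ : UnitaryIrrep Γ) (v w : L2 Γ) :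
    inner ℂ (isoProj τ v) w = inner ℂ v (isoProj τ w) := by
  rw [← inner_conj_symm, inner_isoProj_right, inner_isoProj_right, ← integral_conj,
    ← integral_inv_eq_self]
  refine integral_congr_ae (ae_of_all _ fun k => ?_)
  simp only [map_mul, τ.char_inv, Complex.conj_conj, inner_leftReg_right, inv_inv,
    inner_conj_symm]

/-- The character is a class function, so `P_τ` commutes with translations. -/
lemma isoProj_leftReg (τ : UnitaryIrrep Γ) (h : Γ) (v : L2 Γ) :
    isoProj τ (leftReg h v) = leftReg h (isoProj τ v) := by
  have h1 := (leftRegL h).integral_comp_comm (integrable_isoProj τ v)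
  simp only [leftRegL_apply, leftReg_smul] at h1
  rw [show leftReg h (isoProj τ v) = leftReg h (∫ k, conj (τ.char k) • leftReg k v ∂haarProb Γ)
    from rfl, ← h1, isoProj, ← integral_mul_left_eq_self _ h, ← integral_mul_right_eq_self _ h⁻¹]
  refine integral_congr_ae (ae_of_all _ fun k => ?_)
  simp only [← leftReg_mul, inv_mul_cancel_right, ← mul_assoc, τ.char_conj]

lemma contRep_toLp (f : C(Γ, ℂ)) : contRep (ContinuousMap.toLp 2 (haarProb Γ) ℂ f) = f := by
  have h : ∃ f' : C(Γ, ℂ), ContinuousMap.toLp 2 (haarProb Γ) ℂ f' =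
      ContinuousMap.toLp 2 (haarProb Γ) ℂ f := ⟨f, rfl⟩
  rw [contRep, dif_pos h]
  exact congrArg _ (ContinuousMap.toLp_injective (haarProb Γ) h.choose_spec)

lemma contRep_leftReg_toLp (k : Γ) (f : C(Γ, ℂ)) (x : Γ) :
    contRep (leftReg k (ContinuousMap.toLp 2 (haarProb Γ) ℂ f)) x = f (k⁻¹ * x) := by
  rw [leftReg_toLp, contRep_toLp]
  rfl

variable {τ : UnitaryIrrep Γ} {U : Submodule ℂ (L2 Γ)}

lemma leftReg_mem_isotypic (hU : ∀ k, ∀ v ∈ U, leftReg k v ∈ U) {v : L2 Γ}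
    (hv : v ∈ isotypic τ U) (k : Γ) : leftReg k v ∈ isotypic τ U :=
  ⟨hU k v hv.1, by rw [isoProj_leftReg, hv.2]⟩

lemma integral_mem_of_isClosed {X : Type*} [MeasurableSpace X] {μ : Measure X}
    [IsProbabilityMeasure μ] {V : Submodule ℂ (L2 Γ)} (hV : IsClosed (V : Set (L2 Γ)))
    {f : X → L2 Γ} (hf : ∀ x, f x ∈ V) (hi : Integrable f μ) : ∫ x, f x ∂μ ∈ V :=
  (V.restrictScalars ℝ).convex.integral_mem hV (ae_of_all _ hf) hi

lemma isoProj_mem_isotypic (hcl : IsClosed (U : Set (L2 Γ)))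
    (hU : ∀ k, ∀ v ∈ U, leftReg k v ∈ U) {w : L2 Γ} (hw : w ∈ U) :
    isoProj τ w ∈ isotypic τ U :=
  ⟨integral_mem_of_isClosed hcl (fun k => U.smul_mem _ (hU k w hw)) (integrable_isoProj τ w),
    isoProj_isoProj τ w⟩

lemma evalVec_mem_isotypic (τ : UnitaryIrrep Γ) (U : Submodule ℂ (L2 Γ)) :
    evalVec τ U ∈ isotypic τ U :=
  Submodule.sum_mem _ fun _ _ => Submodule.smul_mem _ _ (Subtype.coe_prop _)

/-- `χ_τ` represents the evaluation at the neutral element. -/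
lemma inner_evalVec {u : L2 Γ} (hu : u ∈ isotypic τ U) :
    inner ℂ (evalVec τ U) u = contRep u 1 := by
  set b := stdOrthonormalBasis ℂ (isotypic τ U)
  choose f hf using fun i => exists_continuous_of_mem_isotypic (b i).2
  have h1 : u = ContinuousMap.toLp 2 (haarProb Γ) ℂ (∑ i, inner ℂ (b i : L2 Γ) u • f i) := by
    have := congrArg (Subtype.val) (b.sum_repr' ⟨u, hu⟩)
    rw [map_sum]
    simp only [map_smul, hf]
    simpa using this.symm
  conv_rhs => rw [h1, contRep_toLp]
  rw [evalVec, sum_inner]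
  simp only [ContinuousMap.coe_sum, Finset.sum_apply, ContinuousMap.coe_smul, Pi.smul_apply,
    smul_eq_mul]
  refine Finset.sum_congr rfl fun i _ => ?_
  rw [inner_smul_left, Complex.conj_conj, mul_comm]
  congr 1
  change contRep (b i : L2 Γ) 1 = f i 1
  rw [← hf i, contRep_toLp]

/-- The isotypic projection in terms of point evaluations. -/
lemma isoProj_toLp_eq_integral (hcl : IsClosed (U : Set (L2 Γ)))
    (hU : ∀ k, ∀ v ∈ U, leftReg k v ∈ U) (W : C(Γ, ℂ))
    (hW : ContinuousMap.toLp 2 (haarProb Γ) ℂ W ∈ U) :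
    isoProj τ (ContinuousMap.toLp 2 (haarProb Γ) ℂ W) =
      ∫ x, W x • leftReg x (evalVec τ U) ∂haarProb Γ := by
  have hint : Integrable (fun x => W x • leftReg x (evalVec τ U)) (haarProb Γ) :=
    integrable_of_continuous (W.continuous.smul (continuous_leftReg _))
  have h1 := isoProj_mem_isotypic (τ := τ) hcl hU hW
  have h2 : ∫ x, W x • leftReg x (evalVec τ U) ∂haarProb Γ ∈ isotypic τ U :=
    integral_mem_of_isClosed (isotypic τ U).closed_of_finiteDimensional
      (fun x => Submodule.smul_mem _ _ (leftReg_mem_isotypic hU (evalVec_mem_isotypic τ U) x)) hint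
  -- Both sides lie in `U_τ`, so it is enough to show that their difference `z`, again in `U_τ`, is
  -- orthogonal to itself.
  rw [← sub_eq_zero]
  set z := isoProj τ (ContinuousMap.toLp 2 (haarProb Γ) ℂ W) -
    ∫ x, W x • leftReg x (evalVec τ U) ∂haarProb Γ with hz
  have hzV : z ∈ isotypic τ U := Submodule.sub_mem _ h1 h2
  obtain ⟨f, hf⟩ := exists_continuous_of_mem_isotypic hzV
  have h3 := (innerSL ℂ z).integral_comp_comm hint
  simp only [innerSL_apply_apply, inner_smul_right] at h3
  have h4 : ∀ x, inner ℂ z (leftReg x (evalVec τ U)) = conj (f x) := by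
    intro x
    rw [inner_leftReg_right, ← inner_conj_symm,
      inner_evalVec (leftReg_mem_isotypic hU hzV x⁻¹), ← hf, contRep_leftReg_toLp, inv_inv, mul_one]
  -- Let `f` be the continuous representative of `z`. Since `P_τ` is self-adjoint and fixes `z`, the
  -- first term is `⟨z, W⟩`. By `h4` the second is `∫ W(x) conj(f(x)) dx`, which is the same number.
  have h5 : inner ℂ z z = 0 := by
    nth_rw 2 [hz]
    rw [inner_sub_right, ← h3, ← inner_isoProj, hzV.2, sub_eq_zero]
    simp only [h4]
    rw [← hf, ContinuousMap.inner_toLp]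
  exact inner_self_eq_zero.1 h5

end Isotypic

/-! ### The matrix coefficient formula -/

section MatrixCoefficient

variable {d : ℕ}

lemma Us_coe (s : ℂ) (k : K d) (v : L2 (K d)) : Us s (k : G d) v = leftReg k v := by
  have hfun : (fun x : K d => Complex.exp (-s * (H ((k : G d)⁻¹ * (x : G d)) : ℂ)) *
      v (kappa ((k : G d)⁻¹ * (x : G d)))) = v ∘ fun x => k⁻¹ * x := by
    funext x
    rw [← Subgroup.coe_inv, ← Subgroup.coe_mul, kappa_coe, H_coe]
    simp
  have hmem : MemLp (fun x : K d => Complex.exp (-s * (H ((k : G d)⁻¹ * (x : G d)) : ℂ)) *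
      v (kappa ((k : G d)⁻¹ * (x : G d)))) 2 (haarProb (K d)) := by
    rw [hfun]
    exact (Lp.memLp v).comp_measurePreserving (measurePreserving_mul_left (haarProb (K d)) k⁻¹)
  rw [Us, dif_pos hmem]
  refine Lp.ext (hmem.coeFn_toLp.trans ?_)
  rw [hfun]
  exact (Lp.coeFn_compMeasurePreserving v
    (measurePreserving_mul_left (haarProb (K d)) k⁻¹)).symm

lemma Us_coe_inv (s : ℂ) (k : K d) (v : L2 (K d)) : Us s (k : G d)⁻¹ v = leftReg k⁻¹ v := by
  rw [← Subgroup.coe_inv, Us_coe]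

lemma continuous_kappa_mul_coe (g : G d) : Continuous fun k : K d => kappa (g * (k : G d)) :=
  continuous_kappa.comp (continuous_const.mul continuous_subtype_val)

lemma continuous_H_mul_coe (g : G d) : Continuous fun k : K d => H (g * (k : G d)) :=
  continuous_H.comp (continuous_const.mul continuous_subtype_val)

/-- The action of `U^s(g)` on continuous functions. -/
noncomputable def UsCont (s : ℂ) (g : G d) (f : C(K d, ℂ)) : C(K d, ℂ) where
  toFun x := Complex.exp (-s * (H (g⁻¹ * (x : G d)) : ℂ)) * f (kappa (g⁻¹ * (x : G d)))
  continuous_toFun := by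
    have h1 := continuous_kappa_mul_coe g⁻¹
    have h2 := continuous_H_mul_coe g⁻¹
    exact (Complex.continuous_exp.comp (continuous_const.mul (Complex.continuous_ofReal.comp h2))).mul
      (f.continuous.comp h1)

lemma Us_toLp (hd : 1 ≤ d) (s : ℂ) (g : G d) (f : C(K d, ℂ)) :
    Us s g (ContinuousMap.toLp 2 (haarProb (K d)) ℂ f) =
      ContinuousMap.toLp 2 (haarProb (K d)) ℂ (UsCont s g f) := by
  have hae : (fun x : K d => Complex.exp (-s * (H (g⁻¹ * (x : G d)) : ℂ)) *
      (ContinuousMap.toLp 2 (haarProb (K d)) ℂ f) (kappa (g⁻¹ * (x : G d))))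
      =ᵐ[haarProb (K d)] ContinuousMap.toLp 2 (haarProb (K d)) ℂ (UsCont s g f) := by
    have h1 := (quasiMeasurePreserving_kappa_mul hd g⁻¹).ae_eq
      (ContinuousMap.coeFn_toLp (p := 2) (𝕜 := ℂ) (haarProb (K d)) f)
    have h2 := ContinuousMap.coeFn_toLp (p := 2) (𝕜 := ℂ) (haarProb (K d)) (UsCont s g f)
    filter_upwards [h1, h2] with x hx1 hx2
    rw [hx2]
    simp only [Function.comp_apply] at hx1
    rw [hx1]
    rfl
  have hmem := (memLp_congr_ae hae).2 (Lp.memLp _)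
  rw [Us, dif_pos hmem]
  exact Lp.ext (hmem.coeFn_toLp.trans hae)

/-- Averaging over a closed subgroup does not change the integral over the group. -/
lemma integral_integral_mul_subgroup {Γ : Type} [Group Γ] [TopologicalSpace Γ]
    [IsTopologicalGroup Γ] [CompactSpace Γ] [MeasurableSpace Γ] [BorelSpace Γ] {H : Subgroup Γ}
    [CompactSpace H] {E : Type*} [NormedAddCommGroup E] [NormedSpace ℝ E] [CompleteSpace E]
    {f : Γ → E}
    (hf : Continuous f) :
    ∫ k, ∫ m : H, f (k * m) ∂haarProb H ∂haarProb Γ = ∫ k, f k ∂haarProb Γ := by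
  have hc : Continuous (Function.uncurry fun (k : Γ) (m : H) => f (k * m)) :=
    hf.comp (continuous_fst.mul (continuous_subtype_val.comp continuous_snd))
  rw [integral_integral_swap_of_hasCompactSupport hc (HasCompactSupport.of_compactSpace _)]
  simp [integral_mul_right_eq_self]

instance (d : ℕ) : SecondCountableTopology (M d) :=
  IsEmbedding.subtypeVal.secondCountableTopology

variable {υ : UnitaryIrrep (M d)} {s : ℝ} {U : Submodule ℂ (L2 (K d))}

lemma IsComplementarySeries.leftReg_mem (hU : IsComplementarySeries υ s U) (k : K d) {v : L2 (K d)}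
    (hv : v ∈ U) : leftReg k v ∈ U := by
  rw [← Us_coe s]
  exact hU.invariant _ v hv

lemma eisT_leftReg_toLp (s : ℂ) (τ : UnitaryIrrep (K d)) (k : K d) (f : C(K d, ℂ)) :
    eisT s U τ (leftReg k⁻¹ (ContinuousMap.toLp 2 (haarProb (K d)) ℂ f)) =
      ∫ m : M d, f (k * m) • leftReg (m : K d) (evalVec τ U) ∂haarProb (M d) := by
  simp only [eisT, contRep_leftReg_toLp, Us_coe, inv_inv]

/-- The integrand of the matrix coefficient formula before averaging over `M`. -/
lemma integral_M_eq (g : G d) (τ : UnitaryIrrep (K d)) (f : C(K d, ℂ)) (k : K d) :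
    ∫ m : M d, (Real.exp ((s - d) * H (g * ((k * m : K d) : G d))) : ℂ) • f (k * m) •
        leftReg (kappa (g * ((k * m : K d) : G d))) (evalVec τ U) ∂haarProb (M d) =
      (Real.exp ((s - d) * H (g * (k : G d))) : ℂ) • leftReg (kappa (g * (k : G d)))
        (eisT s U τ (leftReg k⁻¹ (ContinuousMap.toLp 2 (haarProb (K d)) ℂ f))) := by
  have hint : Integrable (fun m : M d => f (k * m) • leftReg (m : K d) (evalVec τ U))
      (haarProb (M d)) :=
    integrable_of_continuous ((f.continuous.comp (continuous_const.mul
      continuous_subtype_val)).smul ((continuous_leftReg _).comp continuous_subtype_val))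
  -- `λ(κ(gkm)) = λ(κ(gk)) λ(m)`, and the first factor, a bounded operator independent of `m`,
  -- passes through the integral.
  rw [eisT_leftReg_toLp, ← leftRegL_apply, ← (leftRegL _).integral_comp_comm hint, ← integral_smul]
  refine integral_congr_ae (ae_of_all _ fun m => ?_)
  simp only [Subgroup.coe_mul, ← mul_assoc, H_mul_M, kappa_mul_M, leftReg_mul, leftRegL_apply,
    leftReg_smul]

/-- The reproducing formula for `W = U^s(g) f` after the substitution `x = κ(gk)`, which undoes the
action of `g` on the argument of `f`. -/
theorem isoProj_Us_toLp_eq_integral (hd : 1 ≤ d) (hU : IsComplementarySeries υ s U)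
    (τ : UnitaryIrrep (K d)) (g : G d) (f : C(K d, ℂ))
    (hf : ContinuousMap.toLp 2 (haarProb (K d)) ℂ f ∈ U) :
    isoProj τ (Us s g (ContinuousMap.toLp 2 (haarProb (K d)) ℂ f)) =
      ∫ k : K d, (Real.exp ((s - d) * H (g * (k : G d))) : ℂ) • f k •
        leftReg (kappa (g * (k : G d))) (evalVec τ U) ∂haarProb (K d) := by
  have hmem := hU.invariant g _ hf
  rw [Us_toLp hd] at hmem ⊢
  rw [isoProj_toLp_eq_integral hU.isClosed (fun k v hv => hU.leftReg_mem k hv) _ hmem,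
    ← integral_kappa_mul hd g (F := fun x => UsCont s g f x • leftReg x (evalVec τ U))
      (integrable_of_continuous ((UsCont s g f).continuous.smul (continuous_leftReg _))).aestronglyMeasurable]
  refine integral_congr_ae (ae_of_all _ fun k => ?_)
  have h1 : UsCont s g f (kappa (g * (k : G d))) =
      Complex.exp (-s * (H (g⁻¹ * (kappa (g * (k : G d)) : G d)) : ℂ)) *
        f (kappa (g⁻¹ * (kappa (g * (k : G d)) : G d))) := rfl
  simp only [h1, H_inv_mul_kappa, kappa_inv_mul_kappa]
  -- The Jacobian contributes `e^{-d H(gk)}` and the cocycle `e^{s H(gk)}`; together they give the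
  -- exponent `s - d`.
  rw [← algebraMap_smul ℂ (Real.exp (-(d * H (g * (k : G d))))), Complex.coe_algebraMap,
    smul_smul, smul_smul, ← mul_assoc, Complex.ofReal_exp, Complex.ofReal_exp,
    ← Complex.exp_add]
  congr 3
  push_cast
  ring

end MatrixCoefficient

end Eisenstein

/-! ### Conclusion: averaging over `M`. -/

theorem mainTheorem8 (d : ℕ) (hd : 1 ≤ d) (υ : Eisenstein.UnitaryIrrep (Eisenstein.M d)) (s : ℝ)
    (U : Submodule ℂ (Eisenstein.L2 (Eisenstein.K d)))
    (hU : Eisenstein.IsComplementarySeries υ s U)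
    (τ₁ τ₂ : Eisenstein.UnitaryIrrep (Eisenstein.K d))
    (hτ₁ : Eisenstein.IsKType τ₁ U) (hτ₂ : Eisenstein.IsKType τ₂ U)
    (g : Eisenstein.G d) :
    ∀ v ∈ Eisenstein.isotypic τ₁ U,
      MeasureTheory.Integrable (fun k : Eisenstein.K d =>
        (Real.exp ((s - d) * Eisenstein.H (g * (k : Eisenstein.G d))) : ℂ) •
          Eisenstein.Us s (Eisenstein.kappa (g * (k : Eisenstein.G d)) : Eisenstein.G d)
            (Eisenstein.eisT s U τ₂
              (Eisenstein.Us s ((k : Eisenstein.G d)⁻¹) v)))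
        (Eisenstein.haarProb (Eisenstein.K d)) ∧
      Eisenstein.isoProj τ₂ (Eisenstein.Us s g (Eisenstein.isoProj τ₁ v)) =
        ∫ k : Eisenstein.K d,
          (Real.exp ((s - d) * Eisenstein.H (g * (k : Eisenstein.G d))) : ℂ) •
            Eisenstein.Us s (Eisenstein.kappa (g * (k : Eisenstein.G d)) : Eisenstein.G d)
              (Eisenstein.eisT s U τ₂
                (Eisenstein.Us s ((k : Eisenstein.G d)⁻¹) v))
          ∂(Eisenstein.haarProb (Eisenstein.K d)) := by
  open Eisenstein MeasureTheory in
  intro v hv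
  obtain ⟨f, rfl⟩ := exists_continuous_of_mem_isotypic hv
  have hc : Continuous fun k : K d => (Real.exp ((s - d) * H (g * (k : G d))) : ℂ) • f k •
      leftReg (kappa (g * (k : G d))) (evalVec τ₂ U) :=
    (Complex.continuous_ofReal.comp (Real.continuous_exp.comp
      (continuous_const.mul (continuous_H_mul_coe g)))).smul
      (f.continuous.smul ((continuous_leftReg _).comp (continuous_kappa_mul_coe g)))
  have hcM : Continuous (Function.uncurry fun (k : K d) (m : M d) =>
      (Real.exp ((s - d) * H (g * ((k * m : K d) : G d))) : ℂ) • f (k * m) •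
        leftReg (kappa (g * ((k * m : K d) : G d))) (evalVec τ₂ U)) :=
    hc.comp (continuous_fst.mul (continuous_subtype_val.comp continuous_snd))
  -- The integrand becomes the average over `kM` of the single continuous function in `hc`.
  -- Integrability then follows from continuity, and the `M`-average disappears under the integral
  -- over `K`.
  simp only [Us_coe, Us_coe_inv, ← integral_M_eq]
  refine ⟨integrable_of_continuous ?_, ?_⟩
  · simpa only [Measure.restrict_univ] using
      continuous_parametric_integral_of_continuous (μ := haarProb (M d)) hcM isCompact_univ
  · rw [hv.2, isoProj_Us_toLp_eq_integral hd hU τ₂ g f hv.1]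
    exact (integral_integral_mul_subgroup (H := M d) hc).symm
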